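/- Let $\mathfrak V_+$ be the set of germs at $0$ of diffeomorphisms $G$ of $\mathbb R^2\cong\mathbb C$ fixing $0$ with $G(c^1,c^2)=(c^1,g(c^1,c^2))$, $g$ smooth and $\partial g/\partial c^2>0$, and let $\mathsf V_+\subset\mathbb C[[Z,\bar Z]]$ be the set of their infinite jets at $0$, where the jet of $G$ is the Taylor series $\mathsf G=\sum_{p,q}\mathsf G^{(p,\bar q)}Z^p\bar Z^q$ of $z\mapsto G(z)\in\mathbb C$ in $z,\bar z$. The first-order invariant of $\mathsf G\in\mathsf V_+$ is $\mu=\mathsf G^{(0,\bar 1)}/\overline{\mathsf G^{(1,\bar 0)}}$ (so $|\mu|<1$). For $|\mu|<1$ put $$Z_\mu=\frac{1}{1+\bar\mu}Z+\frac{\mu}{1+\mu}\bar Z,\qquad \bar Z_\mu=\frac{\bar\mu}{1+\bar\mu}Z+\frac{1}{1+\mu}\bar Z,$$ and call $\mathsf G$ $\mu$-liftable if in its expansion $\mathsf G=\sum_{p,q}\mathsf G_\mu^{(p,\bar q)}Z_\mu^p\bar Z_\mu^q$ one has $\mathsf G_\mu^{(0,\bar q)}=0$ for all $q\ge 0$.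 Two $m$-tuples $(G_j)$, $(G'_j)$ in $\mathfrak V_+$ are called affine admissible if the germ at $0$ of the multi-valued function $$\sum_{j}\operatorname{Im}(G'_j\ln G'_j-G'_j)-\sum_{j}\operatorname{Im}(G_j\ln G_j-G_j)$$ on $\mathbb C\setminus\{0\}$ (that is, of a function on the universal cover of $\mathbb C\setminus\{0\}$; changing the determinations of the logarithms only adds an integer multiple of $2\pi\operatorname{Re}z$) is single-valued and extends to a function in $C^\infty(\mathbb C;\mathbb C)$. Two $m$-tuples in $\mathsf V_+$ are called affine admissible if they are the tuples of jets of some affine admissible $m$-tuples in $\mathfrak V_+$. **Proposition.** Let $(\mathsf G_j)_{j}$ and $(\mathsf G'_j)_{j}$ be $m$-tuples in $\mathsf V_+$, all of whose entries have the same first-order invariant $\mu$, and suppose that every $\mathsf G_j$ is $\mu$-liftable. Then $(\mathsf G_j)$ and $(\mathsf G'_j)$ are affine admissible if and only if every $\mathsf G'_j$ is $\mu$-liftable and $\sum_j\mathsf G_j=\sum_j\mathsf G'_j$. Moreover, affine admissibility does not depend on representatives here: all $m$-tuples $(G_j)$, $(G'_j)$ in $\mathfrak V_+$ with jets $(\mathsf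 G_j)$, $(\mathsf G'_j)$ are affine admissible if and only if $(\mathsf G_j)$ and $(\mathsf G'_j)$ are. -/

import Mathlib

open scoped ContDiff Topology ComplexConjugate

/-! The plane `ℝ²` is identified with `ℂ` by `z = c¹ + i c²`.  Germs at the origin are given by
representatives `G : ℂ → ℂ`; every notion below depends only on the germ of `G` at `0`. -/

/-- `G` represents a germ at `0` of a diffeomorphism of `ℝ² = ℂ` fixing `0`. -/
def IsDiffeoGerm (G : ℂ → ℂ) : Prop :=
  G 0 = 0 ∧ ∃ e : OpenPartialHomeomorph ℂ ℂ, (0 : ℂ) ∈ e.source ∧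
    ContDiffOn ℝ ∞ e e.source ∧ ContDiffOn ℝ ∞ e.symm e.target ∧ Set.EqOn G e e.source

/-- The set `𝔙₊` of germs of diffeomorphisms of the form `G(c¹, c²) = (c¹, g(c¹, c²))` fixing the
origin, with `∂g/∂c² > 0`.  Here `g = Im G`, and `∂/∂c²` is the derivative in direction `i`. -/
def diffeoVPlus : Set (ℂ → ℂ) :=
  {G | IsDiffeoGerm G ∧ (∀ᶠ z in 𝓝 (0 : ℂ), (G z).re = z.re) ∧
    ∀ᶠ z in 𝓝 (0 : ℂ), 0 < fderiv ℝ (fun w => (G w).im) z Complex.I}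

/-- The Wirtinger derivative `∂f/∂z = (∂f/∂x - i ∂f/∂y) / 2`. -/
noncomputable def wirtingerD (f : ℂ → ℂ) (z : ℂ) : ℂ :=
  (fderiv ℝ f z 1 - Complex.I * fderiv ℝ f z Complex.I) / 2

/-- The Wirtinger derivative `∂f/∂z̄ = (∂f/∂x + i ∂f/∂y) / 2`. -/
noncomputable def wirtingerDbar (f : ℂ → ℂ) (z : ℂ) : ℂ :=
  (fderiv ℝ f z 1 + Complex.I * fderiv ℝ f z Complex.I) / 2

/-- The ring `ℂ[[Z, Z̄]]` of formal power series in two variables: variable `0` is `Z` and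
variable `1` is `Z̄`. -/
abbrev CSeries : Type := MvPowerSeries (Fin 2) ℂ

/-- The coefficient of `Z^p Z̄^q`. -/
noncomputable def zcoeff (p q : ℕ) (A : CSeries) : ℂ :=
  MvPowerSeries.coeff (Finsupp.single 0 p + Finsupp.single 1 q) A

/-- The infinite jet at the origin of a complex valued function, i.e. its Taylor series
`∑ (∂_z^p ∂_z̄^q f)(0) / (p! q!) Z^p Z̄^q`.  For `f = G ∈ 𝔙₊` this is `X + i g(X, Y)` written
in `Z = X + iY` and `Z̄ = X - iY`. -/
noncomputable def jetAtZero (f : ℂ → ℂ) : CSeries := fun n =>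
  (wirtingerD^[n 0] (wirtingerDbar^[n 1] f)) 0 / ((n 0).factorial * (n 1).factorial : ℂ)

/-- The set `V₊` of infinite jets at the origin of elements of `𝔙₊`. -/
def jetVPlus : Set CSeries := jetAtZero '' diffeoVPlus

/-- The first-order invariant `μ`: the coefficient of `Z̄` divided by the conjugate of the
coefficient of `Z`. -/
noncomputable def firstOrderInvariant (A : CSeries) : ℂ :=
  zcoeff 0 1 A / conj (zcoeff 1 0 A)

/-- The linear form `Z_μ = Z / (1 + μ̄) + μ Z̄ / (1 + μ)`. -/
noncomputable def zMu (μ : ℂ) : CSeries :=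
  MvPowerSeries.C (1 / (1 + conj μ)) * MvPowerSeries.X 0 +
    MvPowerSeries.C (μ / (1 + μ)) * MvPowerSeries.X 1

/-- The linear form `Z̄_μ = μ̄ Z / (1 + μ̄) + Z̄ / (1 + μ)`. -/
noncomputable def zBarMu (μ : ℂ) : CSeries :=
  MvPowerSeries.C (conj μ / (1 + conj μ)) * MvPowerSeries.X 0 +
    MvPowerSeries.C (1 / (1 + μ)) * MvPowerSeries.X 1

/-- `B` is the expansion of `A` in the coordinates `(Z_μ, Z̄_μ)`:
`A = ∑ B^{(p,q)} Z_μ^p Z̄_μ^q`.  For `|μ| < 1` the forms `Z_μ, Z̄_μ` are linearly independent,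
so every `A` has exactly one such expansion. -/
def IsMuExpansion (μ : ℂ) (A B : CSeries) : Prop :=
  MvPowerSeries.subst ![zMu μ, zBarMu μ] B = A

/-- `A` is `μ`-liftable: in its expansion in `(Z_μ, Z̄_μ)` the coefficients of all the pure powers
`Z̄_μ^q`, `q ≥ 0`, vanish. -/
def IsMuLiftable (μ : ℂ) (A : CSeries) : Prop :=
  ∃ B, IsMuExpansion μ A B ∧ ∀ q, zcoeff 0 q B = 0

/-! The universal cover of `ℂ ∖ {0}` is `exp : ℂ → ℂ ∖ {0}`; the half planes `{w | Re w < R}` are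
the preimages of the punctured discs around `0`.  A germ of a multi-valued function is a function
on such a half plane. -/

/-- `L` is a determination of `ln G` as a multi-valued germ, i.e. a continuous function with
`exp (L w) = G (exp w)` on the part of the universal cover over a punctured disc. -/
def IsLogOf (G L : ℂ → ℂ) : Prop :=
  ∃ R : ℝ, ContinuousOn L {w : ℂ | w.re < R} ∧
    ∀ w : ℂ, w.re < R → Complex.exp (L w) = G (Complex.exp w)

/-- The germ of `f` on the universal cover is single-valued and smooth at the origin: it is the
pull back of a function in `C^∞(ℂ; ℂ)`. -/
def IsSmoothAtOrigin (f : ℂ → ℂ) : Prop :=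
  ∃ S : ℂ → ℂ, ContDiff ℝ ∞ S ∧ ∃ R : ℝ, ∀ w : ℂ, w.re < R → f w = S (Complex.exp w)

/-- The function `∑ⱼ Im (Gⱼ ln Gⱼ - Gⱼ)` on the universal cover, with `Lⱼ` in place of `ln Gⱼ`. -/
noncomputable def sumImGLogG {m : ℕ} (G L : Fin m → ℂ → ℂ) (w : ℂ) : ℝ :=
  ∑ j, (G j (Complex.exp w) * L j w - G j (Complex.exp w)).im

/-- Two `m`-tuples in `𝔙₊` are affine admissible: `∑ⱼ Im (G'ⱼ ln G'ⱼ - G'ⱼ) - ∑ⱼ Im (Gⱼ ln Gⱼ - Gⱼ)`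
is single-valued and smooth at the origin.  The choice of determinations of the logarithms is
immaterial: another choice adds an integer multiple of `2π Re z` to this function. -/
def AffineAdmissible {m : ℕ} (G G' : Fin m → ℂ → ℂ) : Prop :=
  ∃ L L' : Fin m → ℂ → ℂ, (∀ j, IsLogOf (G j) (L j)) ∧ (∀ j, IsLogOf (G' j) (L' j)) ∧
    IsSmoothAtOrigin (fun w => ((sumImGLogG G' L' w - sumImGLogG G L w : ℝ) : ℂ))

/-- `G` is a tuple of elements of `𝔙₊` with jets `A`. -/
def Represents {m : ℕ} (G : Fin m → ℂ → ℂ) (A : Fin m → CSeries) : Prop :=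
  ∀ j, G j ∈ diffeoVPlus ∧ jetAtZero (G j) = A j

/-- Two `m`-tuples in `V₊` are affine admissible: they are the jets of affine admissible tuples
in `𝔙₊`. -/
def JetAffineAdmissible {m : ℕ} (A A' : Fin m → CSeries) : Prop :=
  ∃ G G' : Fin m → ℂ → ℂ, Represents G A ∧ Represents G' A' ∧ AffineAdmissible G G'

/-!
All members of the two tuples have the same linear part, which is the value at `z, z̄` of the linear
form `Z_μ` (`linearPart_of_mem_diffeoVPlus`).  It is a real-linear isomorphism that preserves the
real part, and in the coordinate `ζ = Z_μ` every germ reads `G = ζ + h` with `h = O(|ζ|²)` purely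
imaginary (`IsVerticalDisplacement`); `G` is `μ`-liftable exactly when the Taylor series of `h` in
`ζ, ζ̄` is divisible by `ζ` (`isMuLiftable_iff`).  Write
`G ln G - G = G ln ζ + (G ln (1 + h / ζ) - G)`.  Since `∑ G' - ∑ G` is purely imaginary, the terms
`G ln ζ` contribute `Im (∑ G' - ∑ G) · ln |ζ|` to the difference of the two sums, and admissibility
means that
`Im (∑ G' - ∑ G) · ln |ζ| + ∑ Im (G' ln (1 + h' / ζ) - G') - ∑ Im (G ln (1 + h / ζ) - G)`
is smooth at the origin (`affineAdmissible_iff`).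

If all the germs are liftable, each quotient `h / ζ` is smooth (`SmoothGerm.div_id`), and so is
`ln (1 + h / ζ)`; if moreover the sums of the jets agree, `Im (∑ G' - ∑ G)` is flat, and its product
with `ln |ζ|` is smooth (`SmoothGerm.mul_log`).

Conversely, multiply the displayed function by `|ζ| ^ (2 K)` and expand the logarithms to order `K`.
Up to a small remainder, this gives an identity `E = D ln |ζ|` with `E` and `D` smooth
(`isBigO_sub_mul_log`).  A Taylor expansion contains no logarithms, so `E` and `D` vanish to high
order (`HasExpansion.le_order_of_sub_mul_log`).  As `K` is arbitrary, `∑ G' - ∑ G` is flat.  To see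
that the `h'` are divisible by `ζ`, let `n` be such that no `h'` contains a power `ζ̄ ^ q` with
`q < n`, and let `c` be the coefficient of `ζ̄ ^ n`.  The coefficient of
`ζ̄ ^ (n (l + 1)) / ζ ^ l` in `G' ln (1 + h' / ζ)` is a nonzero multiple of `c ^ (l + 1)`, since
only the term `c ζ̄ ^ n` of `h'` can contribute (`zcoeff_logPoly`).  Neither the liftable germs, nor
complex conjugates, nor smooth functions contain such a singular monomial, so the sum of the
`c ^ (l + 1)` over the tuple vanishes for all `l ≥ 1`, and therefore every `c` is zero
(`eq_zero_of_sum_pow_eq_zero`).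
-/

open Asymptotics Filter

/-! ### Asymptotic expansions in `z` and `z̄` -/

/-- `f` has the asymptotic expansion `A` at the origin: to every order `N` it is approximated, up to
`O(|z| ^ N)`, by a polynomial in `z, z̄` that agrees with `A` to order `N`.  Allowing any such
polynomial, not only the truncation of `A`, makes products and substitutions immediate. -/
def HasExpansion (f : ℂ → ℂ) (A : CSeries) : Prop :=
  ∀ N : ℕ, ∃ P : MvPolynomial (Fin 2) ℂ, (N : ℕ∞) ≤ (A - (P : CSeries)).order ∧
    (fun z => f z - MvPolynomial.eval ![z, conj z] P) =O[𝓝 0] fun z => ‖z‖ ^ N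

theorem le_order_add {A B : CSeries} {n : ℕ∞} (hA : n ≤ A.order) (hB : n ≤ B.order) :
    n ≤ (A + B).order :=
  (le_min hA hB).trans MvPowerSeries.min_order_le_add

theorem le_order_sub {A B : CSeries} {n : ℕ∞} (hA : n ≤ A.order) (hB : n ≤ B.order) :
    n ≤ (A - B).order := by
  rw [sub_eq_add_neg]
  exact le_order_add hA (by rwa [MvPowerSeries.order_neg])

theorem le_order_mul_left {A : CSeries} {n : ℕ∞} (hA : n ≤ A.order) (B : CSeries) :
    n ≤ (A * B).order :=
  (hA.trans le_self_add).trans MvPowerSeries.le_order_mul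

theorem le_order_mul_right {B : CSeries} {n : ℕ∞} (hB : n ≤ B.order) (A : CSeries) :
    n ≤ (A * B).order := by
  rw [mul_comm]; exact le_order_mul_left hB A

theorem le_order_sub_truncTotal (A : CSeries) (N : ℕ) :
    (N : ℕ∞) ≤ (A - (MvPowerSeries.truncTotal N A : CSeries)).order := by
  refine MvPowerSeries.nat_le_order fun d hd => ?_
  simp [MvPowerSeries.coeff_truncTotal A hd]

theorem isBigO_norm_pow_of_le {M N : ℕ} (h : N ≤ M) :
    (fun z : ℂ => ‖z‖ ^ M) =O[𝓝 0] fun z => ‖z‖ ^ N := by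
  refine IsBigO.of_bound 1 ?_
  filter_upwards [Metric.ball_mem_nhds (0 : ℂ) one_pos] with z hz
  have hz : ‖z‖ < 1 := by simpa using hz
  simpa using pow_le_pow_of_le_one (norm_nonneg z) hz.le h

theorem eval_isBigO {P : MvPolynomial (Fin 2) ℂ} {N : ℕ} (hP : (N : ℕ∞) ≤ (P : CSeries).order) :
    (fun z : ℂ => MvPolynomial.eval ![z, conj z] P) =O[𝓝 0] fun z => ‖z‖ ^ N := by
  simp_rw [MvPolynomial.eval_eq']
  refine IsBigO.fun_sum fun d hd => ?_
  have hdN : N ≤ d 0 + d 1 := by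
    by_contra hlt
    refine MvPolynomial.mem_support_iff.1 hd ?_
    have := MvPowerSeries.coeff_of_lt_order (f := (P : CSeries)) (d := d)
      (lt_of_lt_of_le (by
        rw [Finsupp.degree_eq_sum, Fin.sum_univ_two]; exact_mod_cast not_le.1 hlt) hP)
    simpa using this
  refine (IsBigO.const_mul_left ?_ _).trans (isBigO_norm_pow_of_le hdN)
  refine IsBigO.of_bound 1 (Eventually.of_forall fun z => ?_)
  simp [Fin.prod_univ_two, pow_add]

namespace HasExpansion

variable {f g : ℂ → ℂ} {A B : CSeries}

/-- The remainder estimate holds for every polynomial that agrees with the expansion to the given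
order. -/
theorem isBigO_sub_eval (hf : HasExpansion f A) {N : ℕ} {P : MvPolynomial (Fin 2) ℂ}
    (hP : (N : ℕ∞) ≤ (A - (P : CSeries)).order) :
    (fun z => f z - MvPolynomial.eval ![z, conj z] P) =O[𝓝 0] fun z => ‖z‖ ^ N := by
  obtain ⟨Q, hQ, hfQ⟩ := hf N
  have h : (N : ℕ∞) ≤ ((Q - P : MvPolynomial (Fin 2) ℂ) : CSeries).order := by
    have : ((Q - P : MvPolynomial (Fin 2) ℂ) : CSeries) = (A - P) - (A - Q) := by
      
      rw [sub_sub_sub_cancel_left]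
      exact map_sub (MvPolynomial.coeToMvPowerSeries.ringHom (σ := Fin 2) (R := ℂ)) Q P
    rw [this]; exact le_order_sub hP hQ
  refine (hfQ.add (eval_isBigO h)).congr_left fun z => ?_
  simp

theorem isBigO (hf : HasExpansion f A) {N : ℕ} (hA : (N : ℕ∞) ≤ A.order) :
    f =O[𝓝 0] fun z => ‖z‖ ^ N := by
  simpa using hf.isBigO_sub_eval (P := 0) (N := N) (by simpa using hA)

theorem congr (hf : HasExpansion f A) (h : f =ᶠ[𝓝 0] g) : HasExpansion g A := fun N => by
  obtain ⟨P, hP, hfP⟩ := hf N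
  refine ⟨P, hP, hfP.congr' ?_ EventuallyEq.rfl⟩
  filter_upwards [h] with z hz
  rw [hz]

theorem of_eval (P : MvPolynomial (Fin 2) ℂ) :
    HasExpansion (fun z => MvPolynomial.eval ![z, conj z] P) P := fun N =>
  ⟨P, by simp, by simpa using isBigO_zero _ _⟩

theorem const (c : ℂ) : HasExpansion (fun _ => c) (MvPowerSeries.C c) := by
  simpa using of_eval (MvPolynomial.C c)

theorem id : HasExpansion (fun z => z) (MvPowerSeries.X 0) := by
  simpa using of_eval (MvPolynomial.X 0)

theorem conj_id : HasExpansion (fun z => conj z) (MvPowerSeries.X 1) := by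
  simpa using of_eval (MvPolynomial.X 1)

theorem add (hf : HasExpansion f A) (hg : HasExpansion g B) :
    HasExpansion (fun z => f z + g z) (A + B) := fun N => by
  obtain ⟨P, hP, hfP⟩ := hf N
  obtain ⟨Q, hQ, hgQ⟩ := hg N
  refine ⟨P + Q, ?_, (hfP.add hgQ).congr_left fun z => ?_⟩
  · rw [MvPolynomial.coe_add, add_sub_add_comm]
    exact le_order_add hP hQ
  · simp only [map_add]; ring

theorem mul (hf : HasExpansion f A) (hg : HasExpansion g B) :
    HasExpansion (fun z => f z * g z) (A * B) := fun N => by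
  obtain ⟨P, hP, hfP⟩ := hf N
  obtain ⟨Q, hQ, hgQ⟩ := hg N
  have hf0 : f =O[𝓝 0] fun z => ‖z‖ ^ 0 := hf.isBigO (by simp)
  have hQ0 := eval_isBigO (P := Q) (N := 0) (by simp)
  refine ⟨P * Q, ?_, ?_⟩
  · have : A * B - ((P * Q : MvPolynomial (Fin 2) ℂ) : CSeries) =
        A * (B - Q) + (A - P) * Q := by rw [MvPolynomial.coe_mul]; ring
    rw [this]
    exact le_order_add (le_order_mul_right hQ _) (le_order_mul_left hP _)
  · have h1 : (fun z => f z * (g z - MvPolynomial.eval ![z, conj z] Q)) =O[𝓝 0]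
        fun z => ‖z‖ ^ N := by simpa using hf0.mul hgQ
    have h2 : (fun z => (f z - MvPolynomial.eval ![z, conj z] P) *
        MvPolynomial.eval ![z, conj z] Q) =O[𝓝 0] fun z => ‖z‖ ^ N := by simpa using hfP.mul hQ0
    refine (h1.add h2).congr_left fun z => ?_
    simp only [map_mul]; ring

theorem const_mul (c : ℂ) (hf : HasExpansion f A) :
    HasExpansion (fun z => c * f z) (MvPowerSeries.C c * A) :=
  (const c).mul hf

theorem sub (hf : HasExpansion f A) (hg : HasExpansion g B) :
    HasExpansion (fun z => f z - g z) (A - B) := by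
  have h := hf.add (hg.const_mul (-1))
  have e : A + MvPowerSeries.C (-1) * B = A - B := by simp [sub_eq_add_neg]
  rw [e] at h
  simpa [sub_eq_add_neg] using h

theorem pow (hf : HasExpansion f A) (n : ℕ) : HasExpansion (fun z => f z ^ n) (A ^ n) := by
  induction n with
  | zero => simpa using const 1
  | succ n ih => simpa only [pow_succ] using ih.mul hf

theorem sum {ι : Type*} {s : Finset ι} {F : ι → ℂ → ℂ} {B : ι → CSeries}
    (h : ∀ i ∈ s, HasExpansion (F i) (B i)) :
    HasExpansion (fun z => ∑ i ∈ s, F i z) (∑ i ∈ s, B i) := by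
  classical
  induction s using Finset.induction_on with
  | empty => simpa using const 0
  | insert a s ha ih =>
    simp only [Finset.sum_insert ha]
    exact (h a (Finset.mem_insert_self a s)).add
      (ih fun i hi => h i (Finset.mem_insert_of_mem hi))

end HasExpansion

/-- A polynomial in `z, z̄` that vanishes for all `z ≠ 0` is zero: in real coordinates it vanishes
on a product of infinite sets. -/
theorem eq_zero_of_eval_conj_eq_zero {P : MvPolynomial (Fin 2) ℂ}
    (h : ∀ z : ℂ, z ≠ 0 → MvPolynomial.eval ![z, conj z] P = 0) : P = 0 := by
  let φ : MvPolynomial (Fin 2) ℂ →ₐ[ℂ] MvPolynomial (Fin 2) ℂ := MvPolynomial.aeval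
    ![MvPolynomial.X 0 + MvPolynomial.C Complex.I * MvPolynomial.X 1,
      MvPolynomial.X 0 - MvPolynomial.C Complex.I * MvPolynomial.X 1]
  let ψ : MvPolynomial (Fin 2) ℂ →ₐ[ℂ] MvPolynomial (Fin 2) ℂ := MvPolynomial.aeval
    ![MvPolynomial.C (1 / 2) * (MvPolynomial.X 0 + MvPolynomial.X 1),
      MvPolynomial.C (-Complex.I / 2) * (MvPolynomial.X 0 - MvPolynomial.X 1)]
  have hψφ : ψ (φ P) = P := by
    have : ψ.comp φ = AlgHom.id ℂ _ := by
      refine MvPolynomial.algHom_ext fun i => ?_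
      have hI : (MvPolynomial.C Complex.I * MvPolynomial.C (-Complex.I / 2) :
          MvPolynomial (Fin 2) ℂ) = MvPolynomial.C (1 / 2) := by
        rw [← MvPolynomial.C_mul]; congr 1
        linear_combination (-1 / 2 : ℂ) * Complex.I_mul_I
      have h2 : (MvPolynomial.C (1 / 2) + MvPolynomial.C (1 / 2) : MvPolynomial (Fin 2) ℂ) = 1 := by
        rw [← MvPolynomial.C_add]; norm_num
      have hC (c : ℂ) : ψ (MvPolynomial.C c) = MvPolynomial.C c := ψ.commutes c
      have hX0 : ψ (MvPolynomial.X 0) =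
        MvPolynomial.C (1 / 2) * (MvPolynomial.X 0 + MvPolynomial.X 1) := by simp [ψ]
      have hX1 : ψ (MvPolynomial.X 1) =
        MvPolynomial.C (-Complex.I / 2) * (MvPolynomial.X 0 - MvPolynomial.X 1) := by simp [ψ]
      fin_cases i
      · have : φ (MvPolynomial.X 0) =
          MvPolynomial.X 0 + MvPolynomial.C Complex.I * MvPolynomial.X 1 := by simp [φ]
        simp only [AlgHom.comp_apply, Fin.zero_eta, this, map_add, map_mul, hC, hX0, hX1]
        simp only [← mul_assoc, hI, AlgHom.id_apply]
        linear_combination (MvPolynomial.X 0) * h2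
      · have : φ (MvPolynomial.X 1) =
          MvPolynomial.X 0 - MvPolynomial.C Complex.I * MvPolynomial.X 1 := by simp [φ]
        simp only [AlgHom.comp_apply, Fin.mk_one, this, map_sub, map_mul, hC, hX0, hX1]
        simp only [← mul_assoc, hI, AlgHom.id_apply]
        linear_combination (MvPolynomial.X 1) * h2
    simpa using congrArg (fun F => F P) this
  have hφ : φ P = 0 := by
    refine MvPolynomial.funext_set (fun _ => (fun x : ℝ => (x : ℂ)) '' Set.Ioi 0)
      (fun _ => (Set.Ioi_infinite 0).image Complex.ofReal_injective.injOn) fun x hx => ?_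
    obtain ⟨a, ha, hxa⟩ := hx 0 trivial
    obtain ⟨b, hb, hxb⟩ := hx 1 trivial
    have ha : 0 < a := ha
    have := h (a + Complex.I * b) fun h0 => by simpa [ha.ne'] using congrArg Complex.re h0
    rw [map_zero, ← this]
    simp only [φ, ← MvPolynomial.coe_aeval_eq_eval, RingHom.coe_coe]
    rw [← AlgHom.comp_apply]
    refine congrArg (fun F : MvPolynomial (Fin 2) ℂ →ₐ[ℂ] ℂ => F P) ?_
    refine MvPolynomial.algHom_ext fun i => ?_
    fin_cases i <;> simp [← hxa, ← hxb, sub_eq_add_neg]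
  rw [← hψφ, hφ, map_zero]

/-- The value at `z` of the homogeneous part of degree `n` of a series of order at least `n`. -/
noncomputable def leadingEval (n : ℕ) (A : CSeries) (z : ℂ) : ℂ :=
  MvPolynomial.eval ![z, conj z] (MvPowerSeries.truncTotal (n + 1) A)

theorem leadingEval_real_mul {n : ℕ} {A : CSeries} (hA : (n : ℕ∞) ≤ A.order) (t : ℝ) (z : ℂ) :
    leadingEval n A (t * z) = t ^ n * leadingEval n A z := by
  simp only [leadingEval, MvPolynomial.eval_eq', Finset.mul_sum, Fin.prod_univ_two]
  refine Finset.sum_congr rfl fun d hd => ?_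
  have hdn : d 0 + d 1 = n := by
    have hd := MvPolynomial.mem_support_iff.1 hd
    have hdeg : d.degree = d 0 + d 1 := by rw [Finsupp.degree_eq_sum, Fin.sum_univ_two]
    rw [← hdeg]
    refine le_antisymm ?_ ?_
    · by_contra hlt
      exact hd (MvPowerSeries.coeff_truncTotal_eq_zero A (by omega))
    · by_contra hlt
      refine hd ?_
      rw [MvPowerSeries.coeff_truncTotal A (by omega)]
      exact MvPowerSeries.coeff_of_lt_order
        (lt_of_lt_of_le (by exact_mod_cast not_le.1 hlt) hA)
  simp only [Matrix.cons_val_zero, Matrix.cons_val_one, map_mul, Complex.conj_ofReal, ← hdn]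
  ring

theorem le_order_succ_of_leadingEval {n : ℕ} {A : CSeries}
    (h : ∀ z, z ≠ 0 → leadingEval n A z = 0) : ((n + 1 : ℕ) : ℕ∞) ≤ A.order := by
  refine MvPowerSeries.nat_le_order fun d hd => ?_
  rw [← MvPowerSeries.coeff_truncTotal A hd, eq_zero_of_eval_conj_eq_zero h]
  simp

theorem tendsto_real_mul (z : ℂ) : Tendsto (fun t : ℝ => (t : ℂ) * z) (𝓝[>] 0) (𝓝 0) := by
  have : Continuous fun t : ℝ => (t : ℂ) * z := by fun_prop
  simpa using (this.tendsto 0).mono_left nhdsWithin_le_nhds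

theorem tendsto_real_mul_ne {z : ℂ} (hz : z ≠ 0) :
    Tendsto (fun t : ℝ => (t : ℂ) * z) (𝓝[>] 0) (𝓝[≠] 0) := by
  refine tendsto_nhdsWithin_iff.2 ⟨tendsto_real_mul z, ?_⟩
  filter_upwards [self_mem_nhdsWithin] with t ht
  simpa [hz] using (show (0 : ℝ) < t from ht).ne'

theorem tendsto_log_norm_real_mul {z : ℂ} (hz : z ≠ 0) :
    Tendsto (fun t : ℝ => Real.log ‖(t : ℂ) * z‖) (𝓝[>] 0) atBot := by
  refine Real.tendsto_log_nhdsNE_zero.comp (tendsto_nhdsWithin_iff.2 ⟨?_, ?_⟩)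
  · simpa using (tendsto_real_mul z).norm
  · filter_upwards [self_mem_nhdsWithin] with t ht
    simpa [hz] using (show (0 : ℝ) < t from ht).ne'

theorem tendsto_div_pow_of_isBigO {g : ℂ → ℂ} {l : Filter ℂ} {n : ℕ} {z : ℂ}
    (hg : g =O[l] fun z => ‖z‖ ^ (n + 1))
    (hl : Tendsto (fun t : ℝ => (t : ℂ) * z) (𝓝[>] 0) l) :
    Tendsto (fun t : ℝ => g (t * z) / (t : ℂ) ^ n) (𝓝[>] 0) (𝓝 0) := by
  have h1 := hg.comp_tendsto hl
  have h2 : (fun t : ℝ => g (t * z) / (t : ℂ) ^ n) =O[𝓝[>] 0] fun t : ℝ => t := by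
    have h3 : (fun t : ℝ => ((t : ℂ) ^ n)⁻¹) =O[𝓝[>] 0] fun t : ℝ => (t ^ n)⁻¹ :=
      IsBigO.of_bound 1 (Eventually.of_forall fun t => by simp)
    have h4 := h1.mul h3
    refine h4.trans (IsBigO.of_bound (‖z‖ ^ (n + 1)) ?_)
    filter_upwards [self_mem_nhdsWithin] with t ht
    have ht : 0 < t := ht
    have e : (‖(t : ℂ) * z‖ ^ (n + 1)) * (t ^ n)⁻¹ = ‖z‖ ^ (n + 1) * t := by
      rw [norm_mul, Complex.norm_real, Real.norm_of_nonneg ht.le]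
      field_simp
      ring
    simp only [Function.comp_apply, e]
    rw [Real.norm_of_nonneg (by positivity), Real.norm_of_nonneg ht.le]
  refine h2.trans_tendsto ?_
  exact tendsto_id.mono_left nhdsWithin_le_nhds

namespace HasExpansion

variable {f g : ℂ → ℂ} {A B : CSeries}

theorem tendsto_leadingEval (hf : HasExpansion f A) {n : ℕ} (hA : (n : ℕ∞) ≤ A.order) (z : ℂ) :
    Tendsto (fun t : ℝ => f (t * z) / (t : ℂ) ^ n) (𝓝[>] 0) (𝓝 (leadingEval n A z)) := by
  have h1 := tendsto_div_pow_of_isBigO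
    (hf.isBigO_sub_eval (le_order_sub_truncTotal A (n + 1))) (tendsto_real_mul z)
  have h2 := h1.add_const (leadingEval n A z)
  rw [zero_add] at h2
  refine h2.congr' ?_
  filter_upwards [self_mem_nhdsWithin] with t ht
  have ht : (t : ℂ) ≠ 0 := by exact_mod_cast (show (0 : ℝ) < t from ht).ne'
  have e := leadingEval_real_mul hA t z
  unfold leadingEval at e ⊢
  rw [e]
  field_simp
  ring

/-- A function that is `O(|z| ^ N)` has no expansion coefficients below order `N`: its leading
homogeneous part is a limit along rays. -/
theorem le_order (hf : HasExpansion f A) {N : ℕ} (h : f =O[𝓝 0] fun z => ‖z‖ ^ N) :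
    (N : ℕ∞) ≤ A.order := by
  have key : ∀ n ≤ N, (n : ℕ∞) ≤ A.order := by
    intro n
    induction n with
    | zero => simp
    | succ n ih =>
      intro hn
      refine le_order_succ_of_leadingEval fun z _ => ?_
      exact tendsto_nhds_unique (hf.tendsto_leadingEval (ih (by omega)) z)
        (tendsto_div_pow_of_isBigO (h.trans (isBigO_norm_pow_of_le hn)) (tendsto_real_mul z))
  exact key N le_rfl

theorem unique (hA : HasExpansion f A) (hB : HasExpansion f B) : A = B := by
  rw [← sub_eq_zero, ← MvPowerSeries.order_eq_top_iff, ENat.eq_top_iff_forall_ge]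
  intro N
  exact (hA.sub hB).le_order (by simpa using isBigO_zero _ _)

/-- A smooth function that agrees with `g · ln |z|` up to order `N`, with `g` smooth, has order at
least `N`, and so has `g`: there are no logarithms in a Taylor expansion. -/
theorem le_order_of_sub_mul_log (hf : HasExpansion f A) (hg : HasExpansion g B) {N : ℕ}
    (h : (fun z => f z - g z * (Real.log ‖z‖ : ℂ)) =O[𝓝[≠] 0] fun z => ‖z‖ ^ N) :
    (N : ℕ∞) ≤ A.order ∧ (N : ℕ∞) ≤ B.order := by
  have key : ∀ n ≤ N, (n : ℕ∞) ≤ A.order ∧ (n : ℕ∞) ≤ B.order := by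
    intro n
    induction n with
    | zero => simp
    | succ n ih =>
      intro hn
      obtain ⟨hA, hB⟩ := ih (by omega)
      have hlog {z : ℂ} (hz : z ≠ 0) :
          Tendsto (fun t : ℝ => (((Real.log ‖(t : ℂ) * z‖ : ℝ) : ℂ))⁻¹) (𝓝[>] 0) (𝓝 0) := by
        have h2 := (Complex.continuous_ofReal.tendsto 0).comp (tendsto_inv_atBot_zero.comp
            (tendsto_log_norm_real_mul hz))
        simpa [Function.comp_def] using h2
      have hr {z : ℂ} (hz : z ≠ 0) := tendsto_div_pow_of_isBigO (n := n)
        (h.trans ((isBigO_norm_pow_of_le hn).mono nhdsWithin_le_nhds)) (tendsto_real_mul_ne hz)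
      have hB' : ((n + 1 : ℕ) : ℕ∞) ≤ B.order := by
        refine le_order_succ_of_leadingEval fun z hz => ?_
        refine tendsto_nhds_unique (hg.tendsto_leadingEval hB z) ?_
        have h3 := ((hf.tendsto_leadingEval hA z).sub (hr hz)).mul (hlog hz)
        rw [mul_zero] at h3
        refine h3.congr' ?_
        filter_upwards [(tendsto_log_norm_real_mul hz).eventually_ne_atBot 0] with t ht
        have ht : ((Real.log ‖(t : ℂ) * z‖ : ℝ) : ℂ) ≠ 0 := by exact_mod_cast ht
        field_simp
        ring
      refine ⟨le_order_succ_of_leadingEval fun z hz => ?_, hB'⟩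
      refine tendsto_nhds_unique (hf.tendsto_leadingEval hA z) ?_
      have hg' : Tendsto (fun t : ℝ => g (t * z) * (Real.log ‖(t : ℂ) * z‖ : ℂ) / (t : ℂ) ^ n)
          (𝓝[>] 0) (𝓝 0) := by
        have h1 : Tendsto (fun t : ℝ => ‖(t : ℂ) * z‖ * Real.log ‖(t : ℂ) * z‖) (𝓝[>] 0) (𝓝 0) := by
          have h2 := (Real.continuous_mul_log.tendsto 0).comp
            (norm_zero (E := ℂ) ▸ (tendsto_real_mul z).norm)
          simpa [Function.comp_def] using h2
        have h2 := (Complex.continuous_ofReal.tendsto 0).comp 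
          ((h1.const_mul ‖z‖⁻¹).trans (by simp))
        have h3 := (hg.tendsto_leadingEval hB' z).mul h2
        rw [Complex.ofReal_zero, mul_zero] at h3
        refine h3.congr' ?_
        filter_upwards [self_mem_nhdsWithin] with t ht
        have ht : 0 < t := ht
        have htc : (t : ℂ) ≠ 0 := by exact_mod_cast ht.ne'
        have hzc : (‖z‖ : ℂ) ≠ 0 := by simpa using hz
        simp only [Function.comp_apply, norm_mul, Complex.norm_real, Real.norm_of_nonneg ht.le,
          Complex.ofReal_mul, Complex.ofReal_inv]
        field_simp
        ring
      have h4 := (hr hz).add hg'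
      rw [add_zero] at h4
      refine h4.congr fun t => ?_
      ring
  exact key N le_rfl

end HasExpansion

/-! ### Wirtinger calculus -/

/-- `f` is smooth on a neighbourhood of the origin. -/
def SmoothGerm (f : ℂ → ℂ) : Prop := ∀ᶠ z in 𝓝 (0 : ℂ), ContDiffAt ℝ ∞ f z

/-- The real-linear map `v ↦ a v + b v̄`. -/
noncomputable def wirtingerCLM (a b : ℂ) : ℂ →L[ℝ] ℂ :=
  a • ContinuousLinearMap.id ℝ ℂ + b • (Complex.conjCLE : ℂ →L[ℝ] ℂ)

@[simp] theorem wirtingerCLM_apply (a b v : ℂ) : wirtingerCLM a b v = a * v + b * conj v := by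
  simp [wirtingerCLM]

theorem contDiffAt_wirtingerCLM {n : ℕ∞ω} {a b : ℂ → ℂ} {z : ℂ} (ha : ContDiffAt ℝ n a z)
    (hb : ContDiffAt ℝ n b z) : ContDiffAt ℝ n (fun w => wirtingerCLM (a w) (b w)) z :=
  (ha.smul contDiffAt_const).add (hb.smul contDiffAt_const)

theorem norm_wirtingerCLM_le (a b : ℂ) : ‖wirtingerCLM a b‖ ≤ ‖a‖ + ‖b‖ := by
  refine ContinuousLinearMap.opNorm_le_bound _ (by positivity) fun v => ?_
  rw [wirtingerCLM_apply, add_mul]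
  refine (norm_add_le _ _).trans ?_
  simp

theorem fderiv_eq_wirtingerCLM (f : ℂ → ℂ) (z : ℂ) :
    fderiv ℝ f z = wirtingerCLM (wirtingerD f z) (wirtingerDbar f z) := by
  refine ContinuousLinearMap.ext fun v => ?_
  have hv : v = v.re • (1 : ℂ) + v.im • Complex.I := by simp
  rw [wirtingerCLM_apply, wirtingerD, wirtingerDbar]
  conv_lhs => rw [hv, map_add, map_smul, map_smul]
  have h1 : v + conj v = 2 * v.re := by apply Complex.ext <;> simp; ring
  have h2 : v - conj v = 2 * v.im * Complex.I := by apply Complex.ext <;> simp; ring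
  simp only [Complex.real_smul]
  linear_combination (-(fderiv ℝ f z 1) / 2) * h1 + (Complex.I * fderiv ℝ f z Complex.I / 2) * h2
    + (v.im : ℂ) * (fderiv ℝ f z Complex.I) * Complex.I_mul_I

theorem wirtinger_of_hasFDerivAt {f : ℂ → ℂ} {a b z : ℂ} (h : HasFDerivAt f (wirtingerCLM a b) z) :
    wirtingerD f z = a ∧ wirtingerDbar f z = b := by
  simp only [wirtingerD, wirtingerDbar, h.fderiv, wirtingerCLM_apply, map_one, Complex.conj_I]
  constructor
  · linear_combination (-(a - b) / 2) * Complex.I_mul_I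
  · linear_combination ((a - b) / 2) * Complex.I_mul_I

theorem eventuallyEq_wirtingerD {f g : ℂ → ℂ} {z : ℂ} (h : f =ᶠ[𝓝 z] g) :
    wirtingerD f =ᶠ[𝓝 z] wirtingerD g := by
  filter_upwards [h.fderiv (𝕜 := ℝ)] with w hw
  simp [wirtingerD, hw]

theorem eventuallyEq_wirtingerDbar {f g : ℂ → ℂ} {z : ℂ} (h : f =ᶠ[𝓝 z] g) :
    wirtingerDbar f =ᶠ[𝓝 z] wirtingerDbar g := by
  filter_upwards [h.fderiv (𝕜 := ℝ)] with w hw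
  simp [wirtingerDbar, hw]

namespace SmoothGerm

variable {f g : ℂ → ℂ}

theorem contDiffAt (hf : SmoothGerm f) : ContDiffAt ℝ ∞ f 0 := hf.self_of_nhds

theorem of_contDiff (hf : ContDiff ℝ ∞ f) : SmoothGerm f := Eventually.of_forall fun _ =>
  hf.contDiffAt

theorem const (c : ℂ) : SmoothGerm fun _ => c := of_contDiff contDiff_const

theorem id : SmoothGerm fun z => z := of_contDiff contDiff_id

theorem congr (hf : SmoothGerm f) (h : f =ᶠ[𝓝 0] g) : SmoothGerm g := by
  filter_upwards [hf, h.eventuallyEq_nhds] with z hz hz'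
  exact hz.congr_of_eventuallyEq hz'.symm

theorem add (hf : SmoothGerm f) (hg : SmoothGerm g) : SmoothGerm fun z => f z + g z := by
  filter_upwards [hf, hg] with z h1 h2 using h1.add h2

theorem sub (hf : SmoothGerm f) (hg : SmoothGerm g) : SmoothGerm fun z => f z - g z := by
  filter_upwards [hf, hg] with z h1 h2 using h1.sub h2

theorem mul (hf : SmoothGerm f) (hg : SmoothGerm g) : SmoothGerm fun z => f z * g z := by
  filter_upwards [hf, hg] with z h1 h2 using h1.mul h2

theorem pow (hf : SmoothGerm f) (n : ℕ) : SmoothGerm fun z => f z ^ n := by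
  filter_upwards [hf] with z h1 using h1.pow n

theorem sum {ι : Type*} {s : Finset ι} {F : ι → ℂ → ℂ} (h : ∀ i ∈ s, SmoothGerm (F i)) :
    SmoothGerm fun z => ∑ i ∈ s, F i z := by
  have : ∀ᶠ z in 𝓝 (0 : ℂ), ∀ i ∈ s, ContDiffAt ℝ ∞ (F i) z := (Finset.eventually_all s).2 h
  filter_upwards [this] with z hz using ContDiffAt.sum hz

theorem conjugate (hf : SmoothGerm f) : SmoothGerm fun z => conj (f z) := by
  filter_upwards [hf] with z h1
  exact (Complex.conjCLE.contDiff (n := ∞)).contDiffAt.comp z h1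

theorem eval (P : MvPolynomial (Fin 2) ℂ) :
    SmoothGerm fun z => MvPolynomial.eval ![z, (starRingEnd ℂ) z] P := by
  simp_rw [MvPolynomial.eval_eq', Fin.prod_univ_two]
  exact sum fun d _ => (const _).mul ((id.pow _).mul (id.conjugate.pow _))

theorem comp_continuousLinearEquiv (hf : SmoothGerm f) (e : ℂ ≃L[ℝ] ℂ) :
    SmoothGerm fun z => f (e z) := by
  have he : Tendsto e (𝓝 0) (𝓝 0) := by simpa using e.continuous.tendsto 0
  filter_upwards [he.eventually hf] with z hz
  exact hz.comp z e.contDiff.contDiffAt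

theorem d (hf : SmoothGerm f) : SmoothGerm (wirtingerD f) := by
  filter_upwards [hf] with z hz
  have h := hz.fderiv_right (m := ∞) (by simp)
  exact ((h.clm_apply contDiffAt_const).sub (contDiffAt_const.mul
    (h.clm_apply contDiffAt_const))).div_const 2

theorem dbar (hf : SmoothGerm f) : SmoothGerm (wirtingerDbar f) := by
  filter_upwards [hf] with z hz
  have h := hz.fderiv_right (m := ∞) (by simp)
  exact ((h.clm_apply contDiffAt_const).add (contDiffAt_const.mul
    (h.clm_apply contDiffAt_const))).div_const 2

theorem hasFDerivAt (hf : SmoothGerm f) : ∀ᶠ z in 𝓝 (0 : ℂ),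
    HasFDerivAt f (wirtingerCLM (wirtingerD f z) (wirtingerDbar f z)) z := by
  filter_upwards [hf] with z hz
  rw [← fderiv_eq_wirtingerCLM]
  exact (hz.differentiableAt (by simp)).hasFDerivAt

theorem wirtingerDbar_wirtingerD (hf : SmoothGerm f) :
    wirtingerDbar (wirtingerD f) =ᶠ[𝓝 0]
      wirtingerD (wirtingerDbar f) := by
  filter_upwards [hf] with z hz
  have hd : HasFDerivAt (fderiv ℝ f) (fderiv ℝ (fderiv ℝ f) z) z :=
    ((hz.fderiv_right (m := ∞) (by simp)).differentiableAt (by simp)).hasFDerivAt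
  have hsymm : fderiv ℝ (fderiv ℝ f) z 1 Complex.I = fderiv ℝ (fderiv ℝ f) z Complex.I 1 :=
    hz.isSymmSndFDerivAt (by simpa using (mod_cast le_top : ((2 : ℕ∞) : ℕ∞ω) ≤ ∞)) 1 Complex.I
  have h1 := hd.clm_apply (hasFDerivAt_const (1 : ℂ) z)
  have h2 := hd.clm_apply (hasFDerivAt_const Complex.I z)
  have hD : HasFDerivAt (wirtingerD f) _ z :=
    ((h1.sub (h2.const_mul Complex.I)).mul_const' (2⁻¹ : ℂ)).congr_of_eventuallyEq
      (Eventually.of_forall fun w => by simp [wirtingerD, div_eq_mul_inv])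
  have hDb : HasFDerivAt (wirtingerDbar f) _ z :=
    ((h1.add (h2.const_mul Complex.I)).mul_const' (2⁻¹ : ℂ)).congr_of_eventuallyEq
      (Eventually.of_forall fun w => by simp [wirtingerDbar, div_eq_mul_inv])
  rw [wirtingerDbar, wirtingerD, hD.fderiv, hDb.fderiv]
  simp [hsymm]
  ring

end SmoothGerm

/-! ### Taylor's formula in Wirtinger coordinates -/

theorem coeff_jetAtZero (f : ℂ → ℂ) (d : Fin 2 →₀ ℕ) : MvPowerSeries.coeff d (jetAtZero f) =
    (wirtingerD^[d 0] (wirtingerDbar^[d 1] f)) 0 / ((d 0).factorial * (d 1).factorial : ℂ) := rfl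

theorem coeff_jetAtZero_eq_zero_iff (f : ℂ → ℂ) (d : Fin 2 →₀ ℕ) :
    MvPowerSeries.coeff d (jetAtZero f) = 0 ↔
      (wirtingerD^[d 0] (wirtingerDbar^[d 1] f)) 0 = 0 := by
  rw [coeff_jetAtZero, div_eq_zero_iff]
  simp [Nat.factorial_ne_zero]

theorem nat_le_order_jetAtZero_iff {f : ℂ → ℂ} {N : ℕ} : (N : ℕ∞) ≤ (jetAtZero f).order ↔
    ∀ p q, p + q < N → (wirtingerD^[p] (wirtingerDbar^[q] f)) 0 = 0 := by
  constructor
  · intro h p q hpq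
    have := (coeff_jetAtZero_eq_zero_iff f (Finsupp.single 0 p + Finsupp.single 1 q)).1
      (MvPowerSeries.coeff_of_lt_order (lt_of_lt_of_le (by
        simpa [Finsupp.degree_eq_sum] using mod_cast hpq) h))
    simpa using this
  · intro h
    refine MvPowerSeries.nat_le_order fun d hd => ?_
    rw [coeff_jetAtZero_eq_zero_iff]
    refine h _ _ ?_
    rwa [Finsupp.degree_eq_sum, Fin.sum_univ_two] at hd

theorem eventuallyEq_iterate_wirtingerD {f g : ℂ → ℂ} {z : ℂ} (h : f =ᶠ[𝓝 z] g) (q : ℕ) :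
    wirtingerD^[q] f =ᶠ[𝓝 z] wirtingerD^[q] g := by
  induction q with
  | zero => exact h
  | succ q ih => simpa only [Function.iterate_succ_apply'] using eventuallyEq_wirtingerD ih

namespace SmoothGerm

variable {f g : ℂ → ℂ}

theorem iterate_dbar (hf : SmoothGerm f) (q : ℕ) :
    SmoothGerm (wirtingerDbar^[q] f) := by
  induction q with
  | zero => exact hf
  | succ q ih => simpa only [Function.iterate_succ_apply'] using ih.dbar

theorem iterate_wirtingerDbar_wirtingerD (hf : SmoothGerm f) (q : ℕ) :
    wirtingerDbar^[q] (wirtingerD f) =ᶠ[𝓝 0]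
      wirtingerD (wirtingerDbar^[q] f) := by
  induction q with
  | zero => exact EventuallyEq.rfl
  | succ q ih =>
    rw [Function.iterate_succ_apply', Function.iterate_succ_apply']
    exact (eventuallyEq_wirtingerDbar ih).trans (hf.iterate_dbar q).wirtingerDbar_wirtingerD

theorem nat_le_order_jetAtZero_wirtingerD (hf : SmoothGerm f) {N : ℕ}
    (h : ((N + 1 : ℕ) : ℕ∞) ≤ (jetAtZero f).order) :
    (N : ℕ∞) ≤ (jetAtZero (wirtingerD f)).order := by
  rw [nat_le_order_jetAtZero_iff] at h ⊢
  intro p q hpq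
  rw [(eventuallyEq_iterate_wirtingerD (hf.iterate_wirtingerDbar_wirtingerD q) p).eq_of_nhds]
  exact h (p + 1) q (by omega)

theorem nat_le_order_jetAtZero_wirtingerDbar {N : ℕ}
    (h : ((N + 1 : ℕ) : ℕ∞) ≤ (jetAtZero f).order) :
    (N : ℕ∞) ≤ (jetAtZero (wirtingerDbar f)).order := by
  rw [nat_le_order_jetAtZero_iff] at h ⊢
  exact fun p q hpq => h p (q + 1) (by omega)

/-- Taylor's formula for a function with vanishing Taylor polynomial, by induction on the order: the
Wirtinger derivatives are `O(|z| ^ N)`, so the function is `O(|z| ^ (N + 1))` by the mean value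
inequality. -/
theorem isBigO_of_order_jetAtZero (hf : SmoothGerm f) {N : ℕ}
    (h : (N : ℕ∞) ≤ (jetAtZero f).order) : f =O[𝓝 0] fun z => ‖z‖ ^ N := by
  induction N generalizing f with
  | zero => simpa using hf.contDiffAt.continuousAt.norm.isBoundedUnder_le.isBigO_one ℝ
  | succ N ih =>
    have h0 : f 0 = 0 := by simpa using nat_le_order_jetAtZero_iff.1 h 0 0 (by omega)
    obtain ⟨C, hC0, hC⟩ := (ih hf.d (hf.nat_le_order_jetAtZero_wirtingerD h)).exists_pos
    obtain ⟨C', hC0', hC'⟩ := (ih hf.dbar (nat_le_order_jetAtZero_wirtingerDbar h)).exists_pos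
    obtain ⟨r, hr, hball⟩ := Metric.eventually_nhds_iff_ball.1
      (hC.bound.and (hC'.bound.and hf.hasFDerivAt))
    refine IsBigO.of_bound (C + C') ?_
    filter_upwards [Metric.ball_mem_nhds (0 : ℂ) hr] with z hz
    -- the mean value inequality on the closed ball through `z`
    have hsub {w : ℂ} (hw : w ∈ Metric.closedBall (0 : ℂ) ‖z‖) : w ∈ Metric.ball (0 : ℂ) r := by
      simp only [Metric.mem_ball, Metric.mem_closedBall, dist_zero_right] at *
      exact hw.trans_lt hz
    have hbound : ∀ w ∈ Metric.closedBall (0 : ℂ) ‖z‖,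
        ‖wirtingerCLM (wirtingerD f w) (wirtingerDbar f w)‖
          ≤ (C + C') * ‖z‖ ^ N := by
      intro w hw
      obtain ⟨h1, h2, -⟩ := hball w (hsub hw)
      have hwz : ‖w‖ ≤ ‖z‖ := by simpa using hw
      have hpow : ‖w‖ ^ N ≤ ‖z‖ ^ N := pow_le_pow_left₀ (norm_nonneg w) hwz N
      rw [norm_pow, norm_norm] at h1 h2
      rw [add_mul]
      exact (norm_wirtingerCLM_le _ _).trans (add_le_add
        (h1.trans (mul_le_mul_of_nonneg_left hpow hC0.le))
        (h2.trans (mul_le_mul_of_nonneg_left hpow hC0'.le)))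
    have := (convex_closedBall (0 : ℂ) ‖z‖).norm_image_sub_le_of_norm_hasFDerivWithin_le
      (fun w hw => (hball w (hsub hw)).2.2.hasFDerivWithinAt) hbound
      (x := 0) (y := z) (by simp) (by simp)
    rw [h0, sub_zero, sub_zero] at this
    simpa [pow_succ, mul_assoc] using this

theorem iterate_wirtingerDbar_sub (hf : SmoothGerm f) (hg : SmoothGerm g) (q : ℕ) :
    wirtingerDbar^[q] (fun z => f z - g z) =ᶠ[𝓝 0]
      fun z => wirtingerDbar^[q] f z - wirtingerDbar^[q] g z := by
  induction q with
  | zero => exact EventuallyEq.rfl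
  | succ q ih =>
    simp only [Function.iterate_succ_apply']
    refine (eventuallyEq_wirtingerDbar ih).trans ?_
    filter_upwards [hf.iterate_dbar q, hg.iterate_dbar q] with z h1 h2
    have h1 := h1.differentiableAt (by simp)
    have h2 := h2.differentiableAt (by simp)
    simp only [wirtingerDbar, fderiv_fun_sub h1 h2, sub_apply]
    ring

theorem iterate_d (hf : SmoothGerm f) (q : ℕ) :
    SmoothGerm (wirtingerD^[q] f) := by
  induction q with
  | zero => exact hf
  | succ q ih => simpa only [Function.iterate_succ_apply'] using ih.d

theorem iterate_wirtingerD_sub (hf : SmoothGerm f) (hg : SmoothGerm g) (q : ℕ) :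
    wirtingerD^[q] (fun z => f z - g z) =ᶠ[𝓝 0]
      fun z => wirtingerD^[q] f z - wirtingerD^[q] g z := by
  induction q with
  | zero => exact EventuallyEq.rfl
  | succ q ih =>
    simp only [Function.iterate_succ_apply']
    refine (eventuallyEq_wirtingerD ih).trans ?_
    filter_upwards [hf.iterate_d q, hg.iterate_d q] with z h1 h2
    have h1 := h1.differentiableAt (by simp)
    have h2 := h2.differentiableAt (by simp)
    simp only [wirtingerD, fderiv_fun_sub h1 h2, sub_apply]
    ring

theorem jetAtZero_sub (hf : SmoothGerm f) (hg : SmoothGerm g) :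
    jetAtZero (fun z => f z - g z) = jetAtZero f - jetAtZero g := by
  refine MvPowerSeries.ext fun d => ?_
  rw [map_sub, coeff_jetAtZero, coeff_jetAtZero, coeff_jetAtZero, ← sub_div,
    (eventuallyEq_iterate_wirtingerD (hf.iterate_wirtingerDbar_sub hg (d 1)) (d 0)).eq_of_nhds,
    ((hf.iterate_dbar _).iterate_wirtingerD_sub
      (hg.iterate_dbar _) (d 0)).eq_of_nhds]

end SmoothGerm

theorem hasFDerivAt_monomial (c : ℂ) (p q : ℕ) (z : ℂ) :
    HasFDerivAt (fun z : ℂ => c * (z ^ p * conj z ^ q))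
      (wirtingerCLM (c * p * (z ^ (p - 1) * conj z ^ q))
        (c * q * (z ^ p * conj z ^ (q - 1)))) z := by
  have h1 := (hasFDerivAt_id (𝕜 := ℝ) z).pow p
  have h2 := ((Complex.conjCLE : ℂ →L[ℝ] ℂ).hasFDerivAt (x := z)).pow q
  refine ((h1.mul h2).const_mul c).congr_fderiv (ContinuousLinearMap.ext fun v => ?_)
  simp
  ring

theorem iterate_wirtingerDbar_monomial (c : ℂ) (p q j : ℕ) :
    wirtingerDbar^[j] (fun z => c * (z ^ p * conj z ^ q)) =
      fun z => (c * q.descFactorial j) * (z ^ p * conj z ^ (q - j)) := by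
  induction j with
  | zero => simp
  | succ j ih =>
    rw [Function.iterate_succ_apply', ih]
    funext z
    rw [(wirtinger_of_hasFDerivAt (hasFDerivAt_monomial _ p (q - j) z)).2, Nat.descFactorial_succ,
      Nat.sub_sub]
    push_cast
    ring

theorem iterate_wirtingerD_monomial (c : ℂ) (p q j : ℕ) :
    wirtingerD^[j] (fun z => c * (z ^ p * conj z ^ q)) =
      fun z => (c * p.descFactorial j) * (z ^ (p - j) * conj z ^ q) := by
  induction j with
  | zero => simp
  | succ j ih =>
    rw [Function.iterate_succ_apply', ih]
    funext z
    rw [(wirtinger_of_hasFDerivAt (hasFDerivAt_monomial _ (p - j) q z)).1, Nat.descFactorial_succ,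
      Nat.sub_sub]
    push_cast
    ring

theorem jetAtZero_monomial (c : ℂ) (d : Fin 2 →₀ ℕ) :
    jetAtZero (fun z => c * (z ^ d 0 * conj z ^ d 1)) = MvPowerSeries.monomial d c := by
  classical
  have key (p j : ℕ) : (p.descFactorial j : ℂ) * 0 ^ (p - j) / j.factorial =
      if j = p then 1 else 0 := by
    rcases lt_trichotomy j p with h | h | h
    · simp [h.ne, Nat.sub_ne_zero_of_lt h]
    · simp [h, Nat.descFactorial_self, Nat.factorial_ne_zero]
    · simp [Nat.descFactorial_of_lt h, h.ne']
  refine MvPowerSeries.ext fun e => ?_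
  rw [coeff_jetAtZero, iterate_wirtingerDbar_monomial, iterate_wirtingerD_monomial]
  beta_reduce
  rw [map_zero (starRingEnd ℂ)]
  calc _ = c * ((d 0).descFactorial (e 0) * 0 ^ (d 0 - e 0) / (e 0).factorial) *
        ((d 1).descFactorial (e 1) * 0 ^ (d 1 - e 1) / (e 1).factorial) := by ring
    _ = _ := by
      rw [key, key, MvPowerSeries.coeff_monomial]
      by_cases h : e = d
      · simp [h]
      · rw [if_neg h]
        by_cases h0 : e 0 = d 0
        · have h1 : e 1 ≠ d 1 := fun h1 => h (by ext i; fin_cases i <;> assumption)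
          simp [h1]
        · simp [h0]

theorem jetAtZero_zero : jetAtZero (fun _ => 0) = 0 := by
  simpa using jetAtZero_monomial 0 0

theorem SmoothGerm.jetAtZero_sum {ι : Type*} {s : Finset ι} {F : ι → ℂ → ℂ}
    (h : ∀ i ∈ s, SmoothGerm (F i)) :
    jetAtZero (fun z => ∑ i ∈ s, F i z) = ∑ i ∈ s, jetAtZero (F i) := by
  classical
  induction s using Finset.induction_on with
  | empty => simpa using jetAtZero_zero
  | insert a s ha ih =>
    have hs : SmoothGerm fun z => ∑ i ∈ s, F i z :=
      SmoothGerm.sum fun i hi => h i (Finset.mem_insert_of_mem hi)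
    have hsum : SmoothGerm fun z => ∑ i ∈ insert a s, F i z := SmoothGerm.sum h
    have := hsum.jetAtZero_sub hs
    simp only [Finset.sum_insert ha, add_sub_cancel_right] at this ⊢
    rw [this, ← ih fun i hi => h i (Finset.mem_insert_of_mem hi)]
    ring

theorem jetAtZero_eval (P : MvPolynomial (Fin 2) ℂ) :
    jetAtZero (fun z => MvPolynomial.eval ![z, conj z] P) = P := by
  simp_rw [MvPolynomial.eval_eq', Fin.prod_univ_two]
  simp only [Matrix.cons_val_zero, Matrix.cons_val_one]
  rw [SmoothGerm.jetAtZero_sum fun d _ => (SmoothGerm.const _).mul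
    ((SmoothGerm.id.pow _).mul (SmoothGerm.id.conjugate.pow _))]
  simp_rw [jetAtZero_monomial]
  conv_rhs => rw [P.as_sum]
  rw [← MvPolynomial.coeToMvPowerSeries.ringHom_apply, map_sum]
  simp

/-- Taylor's formula: the jet of a smooth germ is its asymptotic expansion. -/
theorem SmoothGerm.hasExpansion {f : ℂ → ℂ} (hf : SmoothGerm f) :
    HasExpansion f (jetAtZero f) := fun N => by
  refine ⟨MvPowerSeries.truncTotal N (jetAtZero f), le_order_sub_truncTotal _ _, ?_⟩
  refine (hf.sub (SmoothGerm.eval _)).isBigO_of_order_jetAtZero ?_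
  rw [hf.jetAtZero_sub (SmoothGerm.eval _), jetAtZero_eval]
  exact le_order_sub_truncTotal _ _

/-! ### Division by monomials and multiplication by `ln |z|` -/

theorem SmoothGerm.of_punctured {f : ℂ → ℂ} (h : ∀ᶠ z in 𝓝[≠] (0 : ℂ), ContDiffAt ℝ ∞ f z)
    (h0 : ∀ n : ℕ, ContDiffAt ℝ n f 0) : SmoothGerm f := by
  rw [eventually_nhdsWithin_iff] at h
  filter_upwards [h] with z hz
  by_cases hz0 : z = 0
  · rw [hz0]; exact contDiffAt_infty.2 h0
  · exact hz hz0

/-- The inductive step in the proofs that a product of a smooth function vanishing at the origin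
with a singular function is of class `C^n`: it suffices to bound the product by `|z|²` and to
know that the Wirtinger derivatives, computed off the origin, are of class `C^(n-1)`. -/
theorem contDiffAt_succ_of_punctured {f a b : ℂ → ℂ} {n : ℕ}
    (hf : f =O[𝓝 0] fun z => ‖z‖ ^ 2) (ha0 : a 0 = 0) (hb0 : b 0 = 0)
    (hd : ∀ᶠ z in 𝓝[≠] (0 : ℂ), HasFDerivAt f (wirtingerCLM (a z) (b z)) z)
    (ha : ContDiffAt ℝ n a 0) (hb : ContDiffAt ℝ n b 0) :
    ContDiffAt ℝ (n + 1 : ℕ) f 0 := by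
  push_cast
  refine contDiffAt_succ_iff_hasFDerivAt.2
    ⟨fun z => wirtingerCLM (a z) (b z), ?_, contDiffAt_wirtingerCLM ha hb⟩
  rw [eventually_nhdsWithin_iff] at hd
  refine ⟨_, hd, fun z hz => ?_⟩
  by_cases hz0 : z = 0
  · subst hz0
    have h0 : wirtingerCLM (a 0) (b 0) = 0 := by
      ext v; simp [ha0, hb0]
    beta_reduce
    rw [h0]
    exact IsBigO.hasFDerivAt (n := 2) (by simpa using hf) (by norm_num)
  · exact hz hz0

theorem contDiffAt_zero_of_punctured {f : ℂ → ℂ} (hf : f =O[𝓝 0] fun z => ‖z‖ ^ 1) (h0 : f 0 = 0)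
    (hd : ∀ᶠ z in 𝓝[≠] (0 : ℂ), ContDiffAt ℝ ∞ f z) : ContDiffAt ℝ (0 : ℕ) f 0 := by
  refine contDiffAt_zero.2 ⟨_, eventually_nhdsWithin_iff.1 hd, fun z hz => ?_⟩
  refine ContinuousAt.continuousWithinAt ?_
  by_cases hz0 : z = 0
  · subst hz0
    rw [ContinuousAt, h0]
    refine hf.trans_tendsto ?_
    simpa using (continuous_norm (E := ℂ)).tendsto 0
  · exact (hz hz0).continuousAt

namespace SmoothGerm

variable {f : ℂ → ℂ}

theorem apply_zero (h : ((1 : ℕ) : ℕ∞) ≤ (jetAtZero f).order) : f 0 = 0 := by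
  simpa using nat_le_order_jetAtZero_iff.1 h 0 0 (by omega)

theorem isBigO_div_monomial (hf : SmoothGerm f) {a b k : ℕ}
    (h : ((a + b + k : ℕ) : ℕ∞) ≤ (jetAtZero f).order) :
    (fun z => f z / (z ^ a * conj z ^ b)) =O[𝓝 0] fun z => ‖z‖ ^ k := by
  obtain ⟨C, hC0, hC⟩ := (hf.isBigO_of_order_jetAtZero h).exists_pos
  refine IsBigO.of_bound C ?_
  filter_upwards [hC.bound] with z hz
  rw [norm_pow, norm_norm] at hz ⊢
  rw [norm_div, norm_mul, norm_pow, norm_pow, RCLike.norm_conj, ← pow_add]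
  refine div_le_of_le_mul₀ (by positivity) (by positivity) (hz.trans_eq ?_)
  ring

theorem contDiffAt_div_monomial_of_ne (hf : SmoothGerm f) (a b : ℕ) :
    ∀ᶠ z in 𝓝[≠] (0 : ℂ), ContDiffAt ℝ ∞ (fun z => f z / (z ^ a * conj z ^ b)) z := by
  filter_upwards [nhdsWithin_le_nhds hf, self_mem_nhdsWithin] with z hz hz0
  have hz0 : z ≠ 0 := hz0
  have hc : ContDiffAt ℝ ∞ (fun w : ℂ => conj w) z := Complex.conjCLE.contDiff.contDiffAt
  simp_rw [div_eq_mul_inv]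
  exact hz.mul (((contDiffAt_id.pow a).mul (hc.pow b)).inv (by simp [hz0]))

theorem hasFDerivAt_div_monomial (hf : SmoothGerm f) (a b : ℕ) :
    ∀ᶠ z in 𝓝[≠] (0 : ℂ), HasFDerivAt (fun z => f z / (z ^ a * conj z ^ b))
      (wirtingerCLM
        (wirtingerD f z / (z ^ a * conj z ^ b) - a * (f z / (z ^ (a + 1) * conj z ^ b)))
        (wirtingerDbar f z / (z ^ a * conj z ^ b) - b * (f z / (z ^ a * conj z ^ (b + 1))))) z := by
  filter_upwards [nhdsWithin_le_nhds hf.hasFDerivAt, self_mem_nhdsWithin] with z hz hz0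
  have hz0 : z ≠ 0 := hz0
  have hzb : conj z ≠ 0 := by simpa using hz0
  have hg := hasFDerivAt_monomial 1 a b z
  simp only [one_mul] at hg
  have hgz : z ^ a * conj z ^ b ≠ 0 := by simp [hz0]
  have hinv := ((hasDerivAt_inv hgz).hasFDerivAt.restrictScalars ℝ).comp z hg
  have := hz.mul hinv
  simp only [Function.comp_def] at this
  refine this.congr_fderiv (ContinuousLinearMap.ext fun v => ?_)
  have ha : (a : ℂ) * z ^ (a - 1) = a * z ^ a / z := by
    rcases a with _ | a
    · simp
    · field_simp; simp [pow_succ]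
  have hb : (b : ℂ) * conj z ^ (b - 1) = b * conj z ^ b / conj z := by
    rcases b with _ | b
    · simp
    · field_simp; simp [pow_succ]
  have e1 : (a : ℂ) * (z ^ (a - 1) * conj z ^ b) = a * z ^ a / z * conj z ^ b := by
    rw [← ha]; ring
  have e2 : (b : ℂ) * (z ^ a * conj z ^ (b - 1)) = z ^ a * (b * conj z ^ b / conj z) := by
    rw [← hb]; ring
  simp only [add_apply, smul_apply,
    ContinuousLinearMap.comp_apply, wirtingerCLM_apply, smul_eq_mul, e1, e2,
    ContinuousLinearMap.coe_restrictScalars', ContinuousLinearMap.toSpanSingleton_apply]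
  field_simp
  ring

/-- A smooth function that vanishes to high order can be divided by a monomial in `z` and `z̄`. -/
theorem contDiffAt_div_monomial (hf : SmoothGerm f) {n a b : ℕ}
    (h : ((a + b + n + 1 : ℕ) : ℕ∞) ≤ (jetAtZero f).order) :
    ContDiffAt ℝ n (fun z => f z / (z ^ a * conj z ^ b)) 0 := by
  induction n generalizing f a b with
  | zero =>
    refine contDiffAt_zero_of_punctured (hf.isBigO_div_monomial h) ?_
      (hf.contDiffAt_div_monomial_of_ne a b)
    rw [apply_zero (le_trans (by exact_mod_cast (by omega)) h), zero_div]
  | succ n ih =>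
    have mono {k : ℕ} (hk : k ≤ a + b + (n + 1) + 1) : (k : ℕ∞) ≤ (jetAtZero f).order :=
      le_trans (by exact_mod_cast hk) h
    have hD : ((a + b + n + 1 : ℕ) : ℕ∞) ≤ (jetAtZero (wirtingerD f)).order :=
      hf.nat_le_order_jetAtZero_wirtingerD (mono (by omega))
    have hDb : ((a + b + n + 1 : ℕ) : ℕ∞) ≤ (jetAtZero (wirtingerDbar f)).order :=
      nat_le_order_jetAtZero_wirtingerDbar (mono (by omega))
    have h0 : f 0 = 0 := apply_zero (mono (k := 1) (by omega))
    refine contDiffAt_succ_of_punctured (hf.isBigO_div_monomial (mono (by omega))) ?_ ?_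
      (hf.hasFDerivAt_div_monomial a b)
      ((ih hf.d hD).sub (contDiffAt_const.mul (ih hf (mono (by omega)))))
      ((ih hf.dbar hDb).sub (contDiffAt_const.mul (ih hf (mono (by omega)))))
    · rw [h0, apply_zero (le_trans (by exact_mod_cast (by omega)) hD)]; simp
    · rw [h0, apply_zero (le_trans (by exact_mod_cast (by omega)) hDb)]; simp

/-- Division theorem: if the Taylor series of a smooth `f = O(|z|²)` is divisible by `Z`, then
`f / z` is smooth. -/
theorem div_id (hf : SmoothGerm f) (h2 : (2 : ℕ∞) ≤ (jetAtZero f).order)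
    (hdvd : (MvPowerSeries.X 0 : CSeries) ∣ jetAtZero f) : SmoothGerm fun z => f z / z := by
  obtain ⟨A, hA⟩ := hdvd
  refine of_punctured (by simpa using hf.contDiffAt_div_monomial_of_ne 1 0) fun n => ?_
  -- split off a Taylor polynomial, so that the remainder can be divided with a `C^n` quotient
  let P := MvPowerSeries.truncTotal (n + 2) A
  have hr : SmoothGerm fun z => f z - MvPolynomial.eval ![z, conj z] (MvPolynomial.X 0 * P) :=
    hf.sub (eval _)
  have hA0 : P.coeff 0 = 0 := by
    have h1 := MvPowerSeries.coeff_of_lt_order (f := jetAtZero f) (d := Finsupp.single 0 1)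
      (lt_of_lt_of_le (by simp) h2)
    have h2 := MvPowerSeries.coeff_add_monomial_mul (Finsupp.single 0 1) 0 A (1 : ℂ)
    rw [MvPowerSeries.coeff_truncTotal A (by simp), ← one_mul (MvPowerSeries.coeff 0 A), ← h2, ← h1,
      hA, add_zero]
    rfl
  have hr' : ((1 + 0 + n + 1 : ℕ) : ℕ∞) ≤ (jetAtZero fun z =>
      f z - MvPolynomial.eval ![z, conj z] (MvPolynomial.X 0 * P)).order := by
    rw [hf.jetAtZero_sub (eval _), jetAtZero_eval, hA, MvPolynomial.coe_mul, MvPolynomial.coe_X,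
      ← mul_sub]
    exact le_trans (by exact_mod_cast (by omega)) 
      (le_order_mul_right (le_order_sub_truncTotal A (n + 2)) _)
  have h3 := (hr.contDiffAt_div_monomial hr').add
    ((eval P).contDiffAt.of_le (by exact_mod_cast le_top))
  refine h3.congr_of_eventuallyEq (Eventually.of_forall fun z => ?_)
  by_cases hz : z = 0
  · subst hz
    have : MvPolynomial.eval (![0, 0] : Fin 2 → ℂ) P = 0 := by
      have e : (![0, 0] : Fin 2 → ℂ) = 0 := by ext i; fin_cases i <;> rfl
      rw [e, MvPolynomial.eval_zero, MvPolynomial.constantCoeff_eq, hA0]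
    simp [this]
  · simp
    field_simp
    ring

theorem _root_.hasFDerivAt_log_norm {z : ℂ} (hz : z ≠ 0) :
    HasFDerivAt (fun z : ℂ => (Real.log ‖z‖ : ℂ))
      (wirtingerCLM (2⁻¹ * z⁻¹) (2⁻¹ * (conj z)⁻¹)) z := by
  have h1 := Complex.reCLM.hasFDerivAt.comp z (hasFDerivAt_monomial 1 1 1 z)
  have e (w : ℂ) : (w * conj w).re = ‖w‖ ^ 2 := by
    rw [Complex.mul_conj, Complex.ofReal_re, Complex.normSq_eq_norm_sq]
  have hne : ‖z‖ ^ 2 ≠ 0 := by simpa using hz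
  simp only [Function.comp_def, one_mul, pow_one, Complex.reCLM_apply, e] at h1
  have h2 := (Complex.ofRealCLM.hasFDerivAt).comp z ((h1.log hne).const_mul 2⁻¹)
  simp only [Function.comp_def, Real.log_pow, Complex.ofRealCLM_apply] at h2
  refine (h2.congr_of_eventuallyEq (Eventually.of_forall fun w => by simp)).congr_fderiv
    (ContinuousLinearMap.ext fun v => ?_)
  have hzb : conj z ≠ 0 := by simpa using hz
  have e2 : ((‖z‖ : ℂ)) ^ 2 = z * conj z := by
    rw [Complex.mul_conj, Complex.normSq_eq_norm_sq]; simp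
  have e3 : (((conj z * v + z * conj v).re : ℝ) : ℂ) = conj z * v + z * conj v := by
    apply Complex.ext <;> simp
    ring
  simp only [ContinuousLinearMap.comp_apply, smul_apply, wirtingerCLM_apply, Nat.cast_one,
    Nat.sub_self, pow_zero, one_mul, mul_one, Complex.ofRealCLM_apply, Complex.reCLM_apply,
    smul_eq_mul, Complex.ofReal_mul, Complex.ofReal_inv, Complex.ofReal_pow, e2, e3]
  push_cast
  field_simp

theorem isBigO_mul_log (hf : SmoothGerm f) (h : jetAtZero f = 0) (k : ℕ) :
    (fun z => f z * (Real.log ‖z‖ : ℂ)) =O[𝓝 0] fun z => ‖z‖ ^ k := by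
  have h1 : f =O[𝓝 0] fun z => ‖z‖ ^ (k + 1) := hf.isBigO_of_order_jetAtZero (by simp [h])
  have h2 : (fun z : ℂ => ‖z‖ * Real.log ‖z‖) =O[𝓝 0] fun _ => (1 : ℝ) :=
    (((Real.continuous_mul_log.comp continuous_norm).tendsto (0 : ℂ))).isBigO_one ℝ
  have h3 : (fun z => ‖z‖ ^ (k + 1) * Real.log ‖z‖) =O[𝓝 (0 : ℂ)] fun z => ‖z‖ ^ k := by
    have := (isBigO_refl (fun z : ℂ => ‖z‖ ^ k) (𝓝 0)).mul h2
    simpa [pow_succ, mul_assoc] using this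
  refine IsBigO.trans ?_ h3
  refine h1.mul (IsBigO.of_bound 1 (Eventually.of_forall fun z => ?_))
  simp

/-- A flat function multiplied by `ln |z|` is smooth. -/
theorem mul_log (hf : SmoothGerm f) (h : jetAtZero f = 0) :
    SmoothGerm fun z => f z * (Real.log ‖z‖ : ℂ) := by
  have hsm {f : ℂ → ℂ} (hf : SmoothGerm f) :
      ∀ᶠ z in 𝓝[≠] (0 : ℂ), ContDiffAt ℝ ∞ (fun z => f z * (Real.log ‖z‖ : ℂ)) z := by
    filter_upwards [nhdsWithin_le_nhds hf, self_mem_nhdsWithin] with z hz hz0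
    have hz0 : z ≠ 0 := hz0
    exact hz.mul (Complex.ofRealCLM.contDiff.contDiffAt.comp z
      ((contDiffAt_norm ℝ hz0).log (by simpa using hz0)))
  refine of_punctured (hsm hf) fun n => ?_
  induction n generalizing f with
  | zero =>
    refine contDiffAt_zero_of_punctured (hf.isBigO_mul_log h 1) (by simp) (hsm hf)
  | succ n ih =>
    have hD : jetAtZero (wirtingerD f) = 0 := by
      rw [← MvPowerSeries.order_eq_top_iff, ENat.eq_top_iff_forall_ge]
      exact fun N => hf.nat_le_order_jetAtZero_wirtingerD (by simp [h])
    have hDb : jetAtZero (wirtingerDbar f) = 0 := by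
      rw [← MvPowerSeries.order_eq_top_iff, ENat.eq_top_iff_forall_ge]
      exact fun N => nat_le_order_jetAtZero_wirtingerDbar (by simp [h])
    have h0 : f 0 = 0 := apply_zero (by simp [h])
    refine contDiffAt_succ_of_punctured
      (a := fun z => wirtingerD f z * (Real.log ‖z‖ : ℂ) + 2⁻¹ * (f z / (z ^ 1 * conj z ^ 0)))
      (b := fun z => wirtingerDbar f z * (Real.log ‖z‖ : ℂ) + 2⁻¹ * (f z / (z ^ 0 * conj z ^ 1)))
      (hf.isBigO_mul_log h 2) (by simp) (by simp) ?_
      ((ih hf.d hD).add (contDiffAt_const.mul (hf.contDiffAt_div_monomial (by simp [h]))))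
      ((ih hf.dbar hDb).add (contDiffAt_const.mul (hf.contDiffAt_div_monomial (by simp [h]))))
    filter_upwards [nhdsWithin_le_nhds hf.hasFDerivAt, self_mem_nhdsWithin] with z hz hz0
    have hz0 : z ≠ 0 := hz0
    refine (hz.mul (hasFDerivAt_log_norm hz0)).congr_fderiv (ContinuousLinearMap.ext fun v => ?_)
    simp
    ring

end SmoothGerm

/-! ### Linear changes of coordinates -/

/-- Expansions transform by substitution under the real-linear change of coordinates
`z ↦ a z + b z̄`. -/
theorem hasExpansion_comp_linear_iff {f : ℂ → ℂ} {B : CSeries} {a b : ℂ} (e : ℂ ≃L[ℝ] ℂ)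
    (he : ∀ z, e z = a * z + b * conj z) :
    HasExpansion (fun z => f (e z)) (MvPowerSeries.subst
      ![MvPowerSeries.C a * MvPowerSeries.X 0 + MvPowerSeries.C b * MvPowerSeries.X 1,
        MvPowerSeries.C (conj b) * MvPowerSeries.X 0 +
          MvPowerSeries.C (conj a) * MvPowerSeries.X 1] B) ↔ HasExpansion f B := by
  set u : Fin 2 → CSeries :=
    ![MvPowerSeries.C a * MvPowerSeries.X 0 + MvPowerSeries.C b * MvPowerSeries.X 1,
        MvPowerSeries.C (conj b) * MvPowerSeries.X 0 +
          MvPowerSeries.C (conj a) * MvPowerSeries.X 1] with hu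
  let U : Fin 2 → MvPolynomial (Fin 2) ℂ :=
    ![MvPolynomial.C a * MvPolynomial.X 0 + MvPolynomial.C b * MvPolynomial.X 1,
        MvPolynomial.C (conj b) * MvPolynomial.X 0 +
          MvPolynomial.C (conj a) * MvPolynomial.X 1]
  have huU (i : Fin 2) : u i = U i := by fin_cases i <;> simp [u, U]
  have hu0 (i : Fin 2) : (u i).constantCoeff = 0 := by fin_cases i <;> simp [u]
  have hsub : MvPowerSeries.HasSubst u := MvPowerSeries.hasSubst_of_constantCoeff_zero hu0
  have hcoe (P : MvPolynomial (Fin 2) ℂ) :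
      MvPowerSeries.subst u (P : CSeries) = (MvPolynomial.aeval U P : MvPolynomial (Fin 2) ℂ) := by
    rw [MvPowerSeries.subst_coe]
    have : (MvPolynomial.coeToMvPowerSeries.algHom ℂ).comp (MvPolynomial.aeval U) =
        MvPolynomial.aeval (R := ℂ) u := by
      refine MvPolynomial.algHom_ext fun i => ?_
      simp [huU]
    have := congrArg (fun F => F P) this
    simpa using this.symm
  have heval (P : MvPolynomial (Fin 2) ℂ) (z : ℂ) :
      MvPolynomial.eval ![z, conj z] (MvPolynomial.aeval U P) =
        MvPolynomial.eval ![e z, conj (e z)] P := by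
    simp only [← MvPolynomial.coe_aeval_eq_eval, RingHom.coe_coe]
    rw [← AlgHom.comp_apply]
    refine congrArg (fun F : MvPolynomial (Fin 2) ℂ →ₐ[ℂ] ℂ => F P) ?_
    refine MvPolynomial.algHom_ext fun i => ?_
    fin_cases i
    · simp [U, he]
    · simp [U, he]; ring
  have hord {C : CSeries} {N : ℕ∞} (h : N ≤ C.order) : N ≤ (MvPowerSeries.subst u C).order := by
    refine le_trans ?_ (MvPowerSeries.le_order_subst hsub C)
    have h1 : (1 : ℕ∞) ≤ ⨅ i, (u i).order :=
      le_iInf fun i => MvPowerSeries.one_le_order_iff_constCoeff_eq_zero.2 (hu0 i)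
    calc N ≤ 1 * C.order := by rwa [one_mul]
      _ ≤ _ := mul_le_mul_left h1 _
  have hpoly (P : MvPolynomial (Fin 2) ℂ) {N : ℕ∞} (h : N ≤ (B - (P : CSeries)).order) :
      N ≤ (MvPowerSeries.subst u B - ((MvPolynomial.aeval U P : MvPolynomial (Fin 2) ℂ) :
        CSeries)).order := by
    rw [← hcoe, ← MvPowerSeries.subst_sub hsub]
    exact hord h
  have hnorm (e : ℂ ≃L[ℝ] ℂ) (N : ℕ) : (fun z => ‖e z‖ ^ N) =O[𝓝 0] fun z => ‖z‖ ^ N :=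
    ((e : ℂ →L[ℝ] ℂ).isBigO_id (𝓝 0)).norm_norm.pow N
  have htend (e : ℂ ≃L[ℝ] ℂ) : Tendsto e (𝓝 0) (𝓝 0) := by simpa using e.continuous.tendsto 0
  constructor
  · intro h N
    refine ⟨_, le_order_sub_truncTotal B N, ?_⟩
    have h1 := h.isBigO_sub_eval (hpoly _ (le_order_sub_truncTotal B N))
    have h2 := (h1.comp_tendsto (htend e.symm)).trans (hnorm e.symm N)
    simpa only [Function.comp_def, heval, e.apply_symm_apply] using h2
  · intro h N
    obtain ⟨P, hP, hfP⟩ := h N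
    refine ⟨_, hpoly P hP, ?_⟩
    simp only [heval]
    exact (hfP.comp_tendsto (htend e)).trans (hnorm e N)

/-! ### Formal computations -/

/-- If all power sums of exponent at least two vanish, then so do the numbers themselves. -/
theorem eq_zero_of_sum_pow_eq_zero {ι : Type*} [Fintype ι] (c : ι → ℂ)
    (h : ∀ l, 1 ≤ l → ∑ j, c j ^ (l + 1) = 0) (j : ι) : c j = 0 := by
  classical
  have hp (p : Polynomial ℂ) : ∑ j, c j ^ 2 * p.eval (c j) = 0 := by
    simp_rw [Polynomial.eval_eq_sum_range, Finset.mul_sum]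
    rw [Finset.sum_comm]
    refine Finset.sum_eq_zero fun i _ => ?_
    have := h (i + 1) (by omega)
    calc _ = p.coeff i * ∑ j, c j ^ (i + 1 + 1) := by
          rw [Finset.mul_sum]; exact Finset.sum_congr rfl fun j _ => by ring
      _ = 0 := by rw [this, mul_zero]
  by_contra hj
  -- a polynomial that separates `c j` from the other values
  let p : Polynomial ℂ := ∏ u ∈ (Finset.univ.image c).erase (c j), (Polynomial.X - Polynomial.C u)
  have hpe (i : ι) (hi : c i ≠ c j) : p.eval (c i) = 0 := by
    rw [Polynomial.eval_prod]
    exact Finset.prod_eq_zero (i := c i) (by simp [hi]) (by simp)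
  have hpj : p.eval (c j) ≠ 0 := by
    rw [Polynomial.eval_prod]
    refine Finset.prod_ne_zero_iff.2 fun u hu => ?_
    simpa [sub_eq_zero] using (Finset.ne_of_mem_erase hu).symm
  have h1 : ∑ i, c i ^ 2 * p.eval (c i) =
      ((Finset.univ.filter fun i => c i = c j).card : ℂ) * (c j ^ 2 * p.eval (c j)) := by
    rw [← nsmul_eq_mul, ← Finset.sum_const, Finset.sum_filter]
    refine Finset.sum_congr rfl fun i _ => ?_
    split_ifs with hi
    · rw [hi]
    · rw [hpe i hi, mul_zero]
  rw [hp p] at h1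
  have hcard : (Finset.univ.filter fun i => c i = c j).card ≠ 0 :=
    Finset.card_ne_zero.2 ⟨j, by simp⟩
  exact mul_ne_zero (by exact_mod_cast hcard) (mul_ne_zero (pow_ne_zero 2 hj) hpj) h1.symm

/-- The polynomial obtained from `x ^ K (x + y) ln (1 + y / x)` by truncating the logarithmic
series after `K` terms. -/
noncomputable def logPoly {R : Type*} [CommRing R] [Algebra ℂ R] (K : ℕ) (x y : R) : R :=
  ∑ k ∈ Finset.range K, ((-1) ^ k / (k + 1) : ℂ) •
    (y ^ (k + 1) * x ^ (K - k) + y ^ (k + 2) * x ^ (K - 1 - k))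

theorem le_weightedOrder_add {w : Fin 2 → ℕ} {A B : CSeries} {n : ℕ∞} (hA : n ≤ A.weightedOrder w)
    (hB : n ≤ B.weightedOrder w) : n ≤ (A + B).weightedOrder w :=
  (le_min hA hB).trans (MvPowerSeries.min_weightedOrder_le_add w)

theorem le_weightedOrder_mul_of_le {w : Fin 2 → ℕ} {A B : CSeries} {a b c : ℕ}
    (hA : (a : ℕ∞) ≤ A.weightedOrder w) (hB : (b : ℕ∞) ≤ B.weightedOrder w) (h : c ≤ a + b) :
    (c : ℕ∞) ≤ (A * B).weightedOrder w :=
  le_trans (by exact_mod_cast h) ((add_le_add hA hB).trans (MvPowerSeries.le_weightedOrder_mul w))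

theorem le_weightedOrder_pow_of_le {w : Fin 2 → ℕ} {A : CSeries} {a : ℕ}
    (hA : (a : ℕ∞) ≤ A.weightedOrder w) (k : ℕ) :
    ((a * k : ℕ) : ℕ∞) ≤ (A ^ k).weightedOrder w := by
  induction k with
  | zero => simp
  | succ k ih =>
    rw [pow_succ]
    exact le_weightedOrder_mul_of_le ih hA (by rw [mul_add_one])

theorem le_weightedOrder_pow_sub_pow {w : Fin 2 → ℕ} {A B : CSeries} {n : ℕ}
    (hA : (n : ℕ∞) ≤ A.weightedOrder w) (hB : (n : ℕ∞) ≤ B.weightedOrder w)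
    (hAB : ((n + 1 : ℕ) : ℕ∞) ≤ (A - B).weightedOrder w) (k : ℕ) :
    ((n * k + 1 : ℕ) : ℕ∞) ≤ (A ^ k - B ^ k).weightedOrder w := by
  induction k with
  | zero => simp
  | succ k ih =>
    have e : A ^ (k + 1) - B ^ (k + 1) = A ^ k * (A - B) + (A ^ k - B ^ k) * B := by ring
    rw [e]
    exact le_weightedOrder_add
      (le_weightedOrder_mul_of_le (le_weightedOrder_pow_of_le hA k) hAB
        (by rw [mul_add_one]; omega))
      (le_weightedOrder_mul_of_le ih hB (by rw [mul_add_one]; omega))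

theorem weight_pair (n : ℕ) (d : Fin 2 →₀ ℕ) : Finsupp.weight ![n, 1] d = n * d 0 + d 1 := by
  simp [Finsupp.weight_apply, Finsupp.sum_fintype, mul_comm]

/-- With weights `n` for `Z` and `1` for `Z̄`, a series without linear terms whose first pure power
of `Z̄` is `c Z̄ ^ n` is a perturbation of `c Z̄ ^ n`. -/
theorem le_weightedOrder_sub_purePower {h : CSeries} {n : ℕ} (hn : 1 ≤ n)
    (h2 : (2 : ℕ∞) ≤ h.order) (hq : ∀ q < n, zcoeff 0 q h = 0) :
    ((n + 1 : ℕ) : ℕ∞) ≤ (h - MvPowerSeries.monomial (Finsupp.single 1 n)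
      (zcoeff 0 n h)).weightedOrder ![n, 1] := by
  classical
  refine MvPowerSeries.nat_le_weightedOrder _ fun d hd => ?_
  rw [weight_pair] at hd
  rw [map_sub, MvPowerSeries.coeff_monomial]
  by_cases h0 : d 0 = 0
  · have hd1 : d = Finsupp.single 1 (d 1) := by ext i; fin_cases i <;> simp [h0]
    have hc : MvPowerSeries.coeff d h = zcoeff 0 (d 1) h := by
      rw [zcoeff, Finsupp.single_zero, zero_add, ← hd1]
    rw [hc]
    rcases lt_or_eq_of_le (show d 1 ≤ n by omega) with hlt | heq
    · rw [hq _ hlt, if_neg, sub_zero]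
      rintro rfl
      simp at hlt
    · rw [heq] at hd1 ⊢
      simp [hd1]
  · have h01 : d 0 = 1 ∧ d 1 = 0 := by
      have : n * 2 ≤ n * d 0 ∨ d 0 = 1 := by
        rcases Nat.lt_or_ge (d 0) 2 with h | h
        · right; omega
        · left; exact Nat.mul_le_mul_left n h
      rcases this with h | h
      · omega
      · rw [h] at hd; omega
    rw [MvPowerSeries.coeff_of_lt_order (lt_of_lt_of_le _ h2), if_neg, sub_zero]
    · rintro rfl
      simp at h01
    · rw [Finsupp.degree_eq_sum, Fin.sum_univ_two, h01.1, h01.2]; norm_num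

theorem zcoeff_X_pow_mul (p q k : ℕ) (A : CSeries) :
    zcoeff (p + k) q (MvPowerSeries.X 0 ^ k * A) = zcoeff p q A := by
  have := MvPowerSeries.coeff_add_monomial_mul (Finsupp.single 0 k)
    (Finsupp.single 0 p + Finsupp.single 1 q) A (1 : ℂ)
  rw [one_mul] at this
  rw [zcoeff, zcoeff, ← this, MvPowerSeries.X_pow_eq]
  congr 1
  rw [Finsupp.single_add]; abel_nf

theorem zcoeff_X_one_pow_mul (p q k : ℕ) (A : CSeries) :
    zcoeff p (q + k) (MvPowerSeries.X 1 ^ k * A) = zcoeff p q A := by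
  have := MvPowerSeries.coeff_add_monomial_mul (Finsupp.single 1 k)
    (Finsupp.single 0 p + Finsupp.single 1 q) A (1 : ℂ)
  rw [one_mul] at this
  rw [zcoeff, zcoeff, ← this, MvPowerSeries.X_pow_eq]
  congr 1
  rw [Finsupp.single_add]; abel_nf

theorem zcoeff_X_pow_mul_of_lt {p q k : ℕ} (hp : p < k) (A : CSeries) :
    zcoeff p q (MvPowerSeries.X 0 ^ k * A) = 0 :=
  MvPowerSeries.X_pow_dvd_iff.1 (dvd_mul_right _ A) _ (by simpa using hp)

/-- The coefficients of the most singular terms of `(Z + h) ln (1 + h / Z)` are, up to nonzero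
rational factors, the powers of the first coefficient `c` of a pure power of `Z̄` in `h`: in the
weights of `le_weightedOrder_sub_purePower` they are the terms of lowest weight, so they can be
computed for `h = c Z̄ ^ n`. -/
theorem zcoeff_logPoly {h : CSeries} {n K l : ℕ} (hn : 1 ≤ n) (hl : 1 ≤ l) (hlK : l < K)
    (h2 : (2 : ℕ∞) ≤ h.order) (hq : ∀ q < n, zcoeff 0 q h = 0) :
    zcoeff (K - l) (n * (l + 1)) (logPoly K (MvPowerSeries.X 0) h) =
      (-1) ^ l * (1 / (l + 1) - 1 / l) * zcoeff 0 n h ^ (l + 1) := by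
  classical
  set c := zcoeff 0 n h
  set g : CSeries := MvPowerSeries.monomial (Finsupp.single 1 n) c with hg
  have hgw : (n : ℕ∞) ≤ g.weightedOrder ![n, 1] := by
    refine MvPowerSeries.nat_le_weightedOrder _ fun d hd => ?_
    rw [hg, MvPowerSeries.coeff_monomial, if_neg]
    rintro rfl
    simp [weight_pair] at hd
  have hgh := le_weightedOrder_sub_purePower hn h2 hq
  have hhw : (n : ℕ∞) ≤ h.weightedOrder ![n, 1] := by
    have := le_weightedOrder_add hgw (le_trans (by exact_mod_cast n.le_succ) hgh)
    rwa [add_sub_cancel] at this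
  have hXw : (n : ℕ∞) ≤ (MvPowerSeries.X 0 : CSeries).weightedOrder ![n, 1] := by
    refine MvPowerSeries.nat_le_weightedOrder _ fun d hd => ?_
    rw [MvPowerSeries.coeff_X, if_neg]
    rintro rfl
    simp [weight_pair] at hd
  have hdiff : ((n * (K + 1) + 1 : ℕ) : ℕ∞) ≤ (logPoly K (MvPowerSeries.X 0) h -
      logPoly K (MvPowerSeries.X 0) g).weightedOrder ![n, 1] := by
    rw [logPoly, logPoly, ← Finset.sum_sub_distrib]
    refine Finset.sum_induction _ (fun A : CSeries => ((n * (K + 1) + 1 : ℕ) : ℕ∞) ≤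
      A.weightedOrder ![n, 1]) (fun _ _ => le_weightedOrder_add) (by simp) fun k hk => ?_
    have hk : k < K := Finset.mem_range.1 hk
    rw [← smul_sub]
    refine le_trans ?_ (MvPowerSeries.le_weightedOrder_smul _)
    have e : h ^ (k + 1) * MvPowerSeries.X 0 ^ (K - k) +
        h ^ (k + 2) * MvPowerSeries.X 0 ^ (K - 1 - k)
        - (g ^ (k + 1) * MvPowerSeries.X 0 ^ (K - k) +
          g ^ (k + 2) * MvPowerSeries.X 0 ^ (K - 1 - k))
        = (h ^ (k + 1) - g ^ (k + 1)) * MvPowerSeries.X 0 ^ (K - k) +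
          (h ^ (k + 2) - g ^ (k + 2)) * MvPowerSeries.X 0 ^ (K - 1 - k) := by ring
    rw [e]
    refine le_weightedOrder_add
      (le_weightedOrder_mul_of_le (le_weightedOrder_pow_sub_pow hhw hgw hgh _)
        (le_weightedOrder_pow_of_le hXw _) ?_)
      (le_weightedOrder_mul_of_le (le_weightedOrder_pow_sub_pow hhw hgw hgh _)
        (le_weightedOrder_pow_of_le hXw _) ?_)
    · have : K + 1 = (k + 1) + (K - k) := by omega
      rw [this, mul_add]; omega
    · have : K + 1 = (k + 2) + (K - 1 - k) := by omega
      rw [this, mul_add]; omega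
  have hcoeff : zcoeff (K - l) (n * (l + 1)) (logPoly K (MvPowerSeries.X 0) h) =
      zcoeff (K - l) (n * (l + 1)) (logPoly K (MvPowerSeries.X 0) g) := by
    rw [← sub_eq_zero, zcoeff, zcoeff, ← map_sub]
    refine MvPowerSeries.coeff_eq_zero_of_lt_weightedOrder _ (lt_of_lt_of_le ?_ hdiff)
    rw [weight_pair]
    norm_cast
    simp only [Finsupp.add_apply, Finsupp.single_apply]
    simp [← mul_add]
    have : K - l + (l + 1) = K + 1 := by omega
    rw [this]
  have hmon (p q i j : ℕ) : zcoeff p q (g ^ j * MvPowerSeries.X 0 ^ i) =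
      if p = i ∧ q = n * j then c ^ j else 0 := by
    rw [hg, MvPowerSeries.monomial_pow, MvPowerSeries.X_pow_eq, MvPowerSeries.monomial_mul_monomial,
      zcoeff, MvPowerSeries.coeff_monomial, mul_one]
    congr 1
    rw [eq_iff_iff]
    constructor
    · intro h
      have h0 := DFunLike.congr_fun h 0
      have h1 := DFunLike.congr_fun h 1
      simp at h0 h1
      exact ⟨h0, by rw [h1, mul_comm]⟩
    · rintro ⟨rfl, rfl⟩
      ext i; fin_cases i <;> simp [mul_comm]
  have hterm (k : ℕ) (hk : k ∈ Finset.range K) :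
      zcoeff (K - l) (n * (l + 1)) (((-1) ^ k / (k + 1) : ℂ) •
        (g ^ (k + 1) * MvPowerSeries.X 0 ^ (K - k) + g ^ (k + 2) * MvPowerSeries.X 0 ^ (K - 1 - k)))
      = (if k = l then (-1) ^ l / (l + 1) * c ^ (l + 1) else 0) +
        (if k = l - 1 then (-1) ^ (l - 1) / l * c ^ (l + 1) else 0) := by
    have hk : k < K := Finset.mem_range.1 hk
    have e (A B : CSeries) (a : ℂ) (p q : ℕ) :
        zcoeff p q (a • (A + B)) = a * zcoeff p q A + a * zcoeff p q B := by
      simp [zcoeff]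
    rw [e, hmon, hmon]
    have e1 : (K - l = K - k ∧ n * (l + 1) = n * (k + 1)) ↔ k = l := by
      rw [Nat.mul_right_inj (by omega)]; omega
    have e2 : (K - l = K - 1 - k ∧ n * (l + 1) = n * (k + 2)) ↔ k = l - 1 := by
      rw [Nat.mul_right_inj (by omega)]; omega
    simp only [e1, e2]
    congr 1
    · split_ifs with h
      · rw [h]
      · simp
    · split_ifs with h
      · obtain ⟨l, rfl⟩ : ∃ l', l = l' + 1 := ⟨l - 1, by omega⟩
        simp only [Nat.add_sub_cancel] at h ⊢
        rw [h]; push_cast; rfl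
      · simp
  rw [hcoeff, logPoly]
  have hsum : zcoeff (K - l) (n * (l + 1)) (∑ k ∈ Finset.range K, ((-1) ^ k / (k + 1) : ℂ) •
        (g ^ (k + 1) * MvPowerSeries.X 0 ^ (K - k) +
          g ^ (k + 2) * MvPowerSeries.X 0 ^ (K - 1 - k))) =
      ∑ k ∈ Finset.range K, zcoeff (K - l) (n * (l + 1)) (((-1) ^ k / (k + 1) : ℂ) •
        (g ^ (k + 1) * MvPowerSeries.X 0 ^ (K - k) +
          g ^ (k + 2) * MvPowerSeries.X 0 ^ (K - 1 - k))) := by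
    simp only [zcoeff, map_sum]
  rw [hsum, Finset.sum_congr rfl hterm, Finset.sum_add_distrib, Finset.sum_ite_eq',
    Finset.sum_ite_eq', if_pos (Finset.mem_range.2 hlK), if_pos (Finset.mem_range.2 (by omega))]
  obtain ⟨l, rfl⟩ : ∃ l', l = l' + 1 := ⟨l - 1, by omega⟩
  simp only [Nat.add_sub_cancel]
  ring

/-! ### Vertical displacements and their logarithms -/

/-- `ζ ↦ ζ + h ζ` is a smooth germ, tangent to the identity, that preserves the real part. -/
structure IsVerticalDisplacement (h : ℂ → ℂ) : Prop where
  smooth : SmoothGerm h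
  two_le_order : (2 : ℕ∞) ≤ (jetAtZero h).order
  re_eq_zero : ∀ᶠ z in 𝓝 (0 : ℂ), (h z).re = 0

/-- The part of `G ln G - G`, `G = z + h`, that remains after removing `G ln z`.  The principal
logarithm is the relevant one, as `h / z` tends to zero. -/
noncomputable def logRemainder (h : ℂ → ℂ) (z : ℂ) : ℂ :=
  (z + h z) * Complex.log (1 + h z / z) - (z + h z)

/-- The difference `∑ Im (G' ln G' - G') - ∑ Im (G ln G - G)`, where `G' = z + h'` and `G = z + h`
preserve the real part, so that `∑ G' - ∑ G` is purely imaginary and only `Re ln z = ln |z|`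
matters. -/
noncomputable def logDifference {m : ℕ} (h h' : Fin m → ℂ → ℂ) (z : ℂ) : ℝ :=
  (∑ j, h' j z - ∑ j, h j z).im * Real.log ‖z‖ +
    (∑ j, (logRemainder (h' j) z).im - ∑ j, (logRemainder (h j) z).im)

theorem zcoeff_add (p q : ℕ) (A B : CSeries) :
    zcoeff p q (A + B) = zcoeff p q A + zcoeff p q B := map_add _ A B

theorem zcoeff_sub (p q : ℕ) (A B : CSeries) :
    zcoeff p q (A - B) = zcoeff p q A - zcoeff p q B := map_sub _ A B

theorem zcoeff_sum {ι : Type*} (p q : ℕ) (s : Finset ι) (A : ι → CSeries) :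
    zcoeff p q (∑ i ∈ s, A i) = ∑ i ∈ s, zcoeff p q (A i) := map_sum _ A s

theorem zcoeff_eq_zero_of_lt_order {A : CSeries} {N p q : ℕ} (hA : (N : ℕ∞) ≤ A.order)
    (h : p + q < N) : zcoeff p q A = 0 :=
  MvPowerSeries.coeff_of_lt_order (lt_of_lt_of_le (by
    simpa [Finsupp.degree_eq_sum] using mod_cast h) hA)

theorem SmoothGerm.ofReal_im {f : ℂ → ℂ} (hf : SmoothGerm f) :
    SmoothGerm fun z => ((f z).im : ℂ) := by
  filter_upwards [hf] with z hz
  exact ((Complex.ofRealCLM.contDiff.comp Complex.imCLM.contDiff).contDiffAt).comp z hz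

theorem SmoothGerm.logPoly {f : ℂ → ℂ} (hf : SmoothGerm f) (K : ℕ) :
    SmoothGerm fun z => logPoly K z (f z) :=
  SmoothGerm.sum fun k _ => (const _).mul
    (((hf.pow (k + 1)).mul (id.pow (K - k))).add ((hf.pow (k + 2)).mul (id.pow (K - 1 - k))))

theorem HasExpansion.logPoly {f : ℂ → ℂ} {A : CSeries} (hf : HasExpansion f A) (K : ℕ) :
    HasExpansion (fun z => logPoly K z (f z)) (logPoly K (MvPowerSeries.X 0) A) := by
  refine HasExpansion.sum fun k _ => ?_
  simp only [MvPowerSeries.smul_eq_C_mul, smul_eq_mul]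
  exact (((hf.pow (k + 1)).mul (id.pow (K - k))).add
    ((hf.pow (k + 2)).mul (id.pow (K - 1 - k)))).const_mul _

namespace IsVerticalDisplacement

variable {h : ℂ → ℂ}

theorem isBigO (hh : IsVerticalDisplacement h) : h =O[𝓝 0] fun z => ‖z‖ ^ 2 :=
  hh.smooth.isBigO_of_order_jetAtZero (by exact_mod_cast hh.two_le_order)

theorem isBigO_div (hh : IsVerticalDisplacement h) :
    (fun z => h z / z) =O[𝓝 0] fun z => ‖z‖ := by
  simpa using hh.smooth.isBigO_div_monomial (a := 1) (b := 0) (k := 1)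
    (by exact_mod_cast hh.two_le_order)

theorem tendsto_div (hh : IsVerticalDisplacement h) :
    Tendsto (fun z => h z / z) (𝓝 0) (𝓝 0) :=
  hh.isBigO_div.trans_tendsto (by simpa using (continuous_norm (E := ℂ)).tendsto 0)

/-- If the jet of `h` is divisible by `Z`, then `G ln G - G - G ln z`, `G = z + h`, is smooth. -/
theorem smoothGerm_logRemainder (hh : IsVerticalDisplacement h)
    (hdvd : (MvPowerSeries.X 0 : CSeries) ∣ jetAtZero h) : SmoothGerm (logRemainder h) := by
  have hu := hh.smooth.div_id hh.two_le_order hdvd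
  have hlog : SmoothGerm fun z => Complex.log (1 + h z / z) := by
    have hslit : ∀ᶠ z in 𝓝 (0 : ℂ), 1 + h z / z ∈ Complex.slitPlane := by
      have : Tendsto (fun z => 1 + h z / z) (𝓝 0) (𝓝 1) := by
        simpa using hh.tendsto_div.const_add 1
      exact this.eventually (Complex.isOpen_slitPlane.mem_nhds (by simp))
    filter_upwards [hu, hslit] with z hz hz'
    exact ((Complex.contDiffAt_log hz').restrict_scalars ℝ).comp z (contDiffAt_const.add hz)
  have hg := SmoothGerm.id.add hh.smooth
  exact (hg.mul hlog).sub hg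

/-- The expansion of `(z + h) ln (1 + h / z)` with poles at the origin, after clearing
denominators. -/
theorem isBigO_logRemainder (hh : IsVerticalDisplacement h) (K : ℕ) :
    (fun z => z ^ K * (logRemainder h z + (z + h z)) - logPoly K z (h z)) =O[𝓝[≠] 0]
      fun z => ‖z‖ ^ (2 * K + 2) := by
  have hl := hh.tendsto_div
  have h1 : (fun z => Complex.log (1 + h z / z) - Complex.logTaylor (K + 1) (h z / z)) =O[𝓝 0]
      fun z => ‖z‖ ^ (K + 1) :=
    ((Complex.log_sub_logTaylor_isBigO K).comp_tendsto hl).trans (hh.isBigO_div.pow (K + 1))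
  have h2 : (fun z => z + h z) =O[𝓝 0] fun z => ‖z‖ ^ 1 :=
    (IsBigO.of_bound 1 (by simp)).add (hh.isBigO.trans (isBigO_norm_pow_of_le (by norm_num)))
  have h3 : (fun z : ℂ => z ^ K) =O[𝓝 0] fun z => ‖z‖ ^ K := IsBigO.of_bound 1 (by simp)
  have h4 := ((h3.mul h2).mul h1).mono (nhdsWithin_le_nhds (s := {0}ᶜ))
  refine (h4.congr' ?_ ?_)
  · filter_upwards [self_mem_nhdsWithin] with z hz
    have hz : z ≠ 0 := hz
    have e : logPoly K z (h z) = z ^ K * (z + h z) * Complex.logTaylor (K + 1) (h z / z) := by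
      rw [logPoly, Complex.logTaylor, Finset.sum_range_succ']
      simp only [Nat.cast_zero, div_zero, add_zero, Finset.mul_sum]
      refine Finset.sum_congr rfl fun k hk => ?_
      obtain ⟨i, rfl⟩ : ∃ i, K = k + 1 + i :=
        ⟨K - (k + 1), by have := Finset.mem_range.1 hk; omega⟩
      have e1 : k + 1 + i - k = i + 1 := by omega
      have e2 : k + 1 + i - 1 - k = i := by omega
      have hk1 : (k : ℂ) + 1 ≠ 0 := by exact_mod_cast k.succ_ne_zero
      rw [e1, e2, smul_eq_mul, div_pow]
      push_cast
      field_simp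
      ring
    rw [e, logRemainder]
    ring
  · exact Eventually.of_forall fun z => by ring

end IsVerticalDisplacement

section LogDifference

variable {m : ℕ} {h h' : Fin m → ℂ → ℂ}

theorem smoothGerm_logDifference (hh : ∀ j, IsVerticalDisplacement (h j))
    (hh' : ∀ j, IsVerticalDisplacement (h' j))
    (hdvd : ∀ j, (MvPowerSeries.X 0 : CSeries) ∣ jetAtZero (h j))
    (hdvd' : ∀ j, (MvPowerSeries.X 0 : CSeries) ∣ jetAtZero (h' j))
    (hsum : ∑ j, jetAtZero (h j) = ∑ j, jetAtZero (h' j)) :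
    SmoothGerm fun z => (logDifference h h' z : ℂ) := by
  have hs := SmoothGerm.sum (s := Finset.univ) fun j _ => (hh j).smooth
  have hs' := SmoothGerm.sum (s := Finset.univ) fun j _ => (hh' j).smooth
  have hδ := hs'.sub hs
  have hjet : jetAtZero (fun z => ∑ j, h' j z - ∑ j, h j z) = 0 := by
    rw [hs'.jetAtZero_sub hs, SmoothGerm.jetAtZero_sum fun j _ => (hh j).smooth,
      SmoothGerm.jetAtZero_sum fun j _ => (hh' j).smooth, hsum, sub_self]
  have hδ' : (fun z => -Complex.I * (∑ j, h' j z - ∑ j, h j z)) =ᶠ[𝓝 0]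
      fun z => ((∑ j, h' j z - ∑ j, h j z).im : ℂ) := by
    filter_upwards [eventually_all.2 fun j => (hh j).re_eq_zero,
      eventually_all.2 fun j => (hh' j).re_eq_zero] with z hz hz'
    apply Complex.ext <;> simp [hz, hz']
  have hjet' : jetAtZero (fun z => ((∑ j, h' j z - ∑ j, h j z).im : ℂ)) = 0 := by
    refine hδ.ofReal_im.hasExpansion.unique ?_
    have := (hδ.hasExpansion.const_mul (-Complex.I)).congr hδ'
    rwa [hjet, mul_zero] at this
  have h1 := hδ.ofReal_im.mul_log hjet'
  have h2 := SmoothGerm.sum (s := Finset.univ) fun j _ =>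
    ((hh j).smoothGerm_logRemainder (hdvd j)).ofReal_im
  have h3 := SmoothGerm.sum (s := Finset.univ) fun j _ =>
    ((hh' j).smoothGerm_logRemainder (hdvd' j)).ofReal_im
  refine (h1.add (h3.sub h2)).congr (Eventually.of_forall fun z => ?_)
  simp [logDifference]

/-- After multiplication by `|z| ^ (2 K)`, the difference of the logarithmic terms is smooth up to
order `3 K + 2`, apart from a multiple of `ln |z|`. -/
theorem isBigO_sub_mul_log {S : ℂ → ℂ} (hh : ∀ j, IsVerticalDisplacement (h j))
    (hh' : ∀ j, IsVerticalDisplacement (h' j))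
    (hS : ∀ᶠ z in 𝓝[≠] (0 : ℂ), S z = logDifference h h' z) (K : ℕ) :
    (fun z => ((z * conj z) ^ K * (2 * Complex.I * S z +
        ∑ j, (z + h' j z - conj (z + h' j z)) - ∑ j, (z + h j z - conj (z + h j z))) -
      ∑ j, (conj z ^ K * logPoly K z (h' j z) - z ^ K * conj (logPoly K z (h' j z))) +
      ∑ j, (conj z ^ K * logPoly K z (h j z) - z ^ K * conj (logPoly K z (h j z)))) -
      2 * ((z * conj z) ^ K * (∑ j, h' j z - ∑ j, h j z)) * (Real.log ‖z‖ : ℂ)) =O[𝓝[≠] 0]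
      fun z => ‖z‖ ^ (3 * K + 2) := by
  have hpow : (fun z : ℂ => z ^ K) =O[𝓝[≠] 0] fun z => ‖z‖ ^ K := IsBigO.of_bound 1 (by simp)
  have hpow' : (fun z : ℂ => conj z ^ K) =O[𝓝[≠] 0] fun z => ‖z‖ ^ K := IsBigO.of_bound 1 (by simp)
  have key {h : ℂ → ℂ} (hh : IsVerticalDisplacement h) :
      (fun z => conj z ^ K * (z ^ K * (logRemainder h z + (z + h z)) - logPoly K z (h z)) -
        z ^ K * conj (z ^ K * (logRemainder h z + (z + h z)) - logPoly K z (h z))) =O[𝓝[≠] 0]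
      fun z => ‖z‖ ^ (3 * K + 2) := by
    have h1 := hh.isBigO_logRemainder K
    have h2 : (fun z => conj (z ^ K * (logRemainder h z + (z + h z)) - logPoly K z (h z)))
        =O[𝓝[≠] 0] fun z => ‖z‖ ^ (2 * K + 2) :=
      IsBigO.of_norm_left (by simpa only [RCLike.norm_conj] using h1.norm_left)
    refine ((hpow'.mul h1).sub (hpow.mul h2)).congr_right fun z => by ring
  have hsum := (IsBigO.fun_sum (s := Finset.univ) fun j _ => key (hh' j)).sub
    (IsBigO.fun_sum (s := Finset.univ) fun j _ => key (hh j))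
  refine hsum.congr' ?_ EventuallyEq.rfl
  have hre : ∀ᶠ z in 𝓝[≠] (0 : ℂ), ∀ j, (h j z).re = 0 :=
    nhdsWithin_le_nhds (eventually_all.2 fun j => (hh j).re_eq_zero)
  have hre' : ∀ᶠ z in 𝓝[≠] (0 : ℂ), ∀ j, (h' j z).re = 0 :=
    nhdsWithin_le_nhds (eventually_all.2 fun j => (hh' j).re_eq_zero)
  filter_upwards [hS, hre, hre'] with z hSz hz hz'
  have him (w : ℂ) : 2 * Complex.I * (w.im : ℂ) = w - conj w := by
    apply Complex.ext <;> simp; ring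
  have hδ : 2 * Complex.I * ((∑ j, h' j z - ∑ j, h j z).im : ℂ) =
      2 * (∑ j, h' j z - ∑ j, h j z) := by
    apply Complex.ext <;> simp [hz, hz']
  have hexp : 2 * Complex.I * S z = 2 * (∑ j, h' j z - ∑ j, h j z) * (Real.log ‖z‖ : ℂ) +
      (∑ j, (logRemainder (h' j) z - conj (logRemainder (h' j) z)) -
        ∑ j, (logRemainder (h j) z - conj (logRemainder (h j) z))) := by
    rw [hSz, ← hδ, logDifference]
    simp_rw [← him, ← Finset.mul_sum]
    push_cast
    ring
  have hterm (h : ℂ → ℂ) :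
      conj z ^ K * (z ^ K * (logRemainder h z + (z + h z)) - logPoly K z (h z)) -
        z ^ K * conj (z ^ K * (logRemainder h z + (z + h z)) - logPoly K z (h z)) =
      (z * conj z) ^ K * (logRemainder h z - conj (logRemainder h z)) +
      (z * conj z) ^ K * (z + h z - conj (z + h z)) -
      (conj z ^ K * logPoly K z (h z) - z ^ K * conj (logPoly K z (h z))) := by
    simp only [map_sub, map_mul, map_add, map_pow]
    ring
  have hsum (h : Fin m → ℂ → ℂ) :
      ∑ j, (conj z ^ K * (z ^ K * (logRemainder (h j) z + (z + h j z)) - logPoly K z (h j z)) -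
        z ^ K * conj (z ^ K * (logRemainder (h j) z + (z + h j z)) - logPoly K z (h j z))) =
      (z * conj z) ^ K * ∑ j, (logRemainder (h j) z - conj (logRemainder (h j) z)) +
      (z * conj z) ^ K * ∑ j, (z + h j z - conj (z + h j z)) -
      ∑ j, (conj z ^ K * logPoly K z (h j z) - z ^ K * conj (logPoly K z (h j z))) := by
    rw [Finset.sum_congr rfl fun j _ => hterm (h j), Finset.sum_sub_distrib,
      Finset.sum_add_distrib, ← Finset.mul_sum, ← Finset.mul_sum]
  rw [hsum, hsum, hexp]
  ring

/-- If the difference of the logarithmic terms is smooth and the jets of the `h j` are divisible by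
`Z`, then the sums of the jets agree and the jets of the `h' j` are divisible by `Z`. -/
theorem jets_of_smooth_logDifference {S : ℂ → ℂ} (hh : ∀ j, IsVerticalDisplacement (h j))
    (hh' : ∀ j, IsVerticalDisplacement (h' j))
    (hdvd : ∀ j, (MvPowerSeries.X 0 : CSeries) ∣ jetAtZero (h j)) (hSm : SmoothGerm S)
    (hS : ∀ᶠ z in 𝓝[≠] (0 : ℂ), S z = logDifference h h' z) :
    (∀ j, (MvPowerSeries.X 0 : CSeries) ∣ jetAtZero (h' j)) ∧
      ∑ j, jetAtZero (h j) = ∑ j, jetAtZero (h' j) := by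
  obtain ⟨σ, hσ⟩ : ∃ σ, HasExpansion (fun z => 2 * Complex.I * S z +
      ∑ j, (z + h' j z - conj (z + h' j z)) - ∑ j, (z + h j z - conj (z + h j z))) σ := by
    refine ⟨_, SmoothGerm.hasExpansion (((SmoothGerm.const (2 * Complex.I)).mul hSm).add
      (SmoothGerm.sum fun j _ => ?_) |>.sub (SmoothGerm.sum fun j _ => ?_))⟩
    · exact (SmoothGerm.id.add (hh' j).smooth).sub (SmoothGerm.id.add (hh' j).smooth).conjugate
    · exact (SmoothGerm.id.add (hh j).smooth).sub (SmoothGerm.id.add (hh j).smooth).conjugate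
  have hzz (K : ℕ) : HasExpansion (fun z => (z * conj z) ^ K)
      ((MvPowerSeries.X 0 * MvPowerSeries.X 1) ^ K) :=
    (HasExpansion.id.mul HasExpansion.conj_id).pow K
  have hδ := (HasExpansion.sum (s := Finset.univ) fun j _ => (hh' j).smooth.hasExpansion).sub
    (HasExpansion.sum (s := Finset.univ) fun j _ => (hh j).smooth.hasExpansion)
  have hconj {h : Fin m → ℂ → ℂ} (hh : ∀ j, IsVerticalDisplacement (h j)) (K : ℕ) (j : Fin m) :=
    ((hh j).smooth.logPoly K).conjugate.hasExpansion
  have hW {h : Fin m → ℂ → ℂ} (hh : ∀ j, IsVerticalDisplacement (h j)) (K : ℕ) :=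
    HasExpansion.sum (s := Finset.univ) fun j _ =>
      ((HasExpansion.conj_id.pow K).mul ((hh j).smooth.hasExpansion.logPoly K)).sub
        ((HasExpansion.id.pow K).mul (hconj hh K j))
  -- the logarithmic and the smooth part vanish to order `3 K + 2`
  have key (K : ℕ) := ((((hzz K).mul hσ).sub (hW hh' K)).add (hW hh K)).le_order_of_sub_mul_log
    (((hzz K).mul hδ).const_mul 2) (isBigO_sub_mul_log hh hh' hS K)
  constructor
  · -- the coefficient of `Z ^ (K - l) * Z̄ ^ (K + n (l + 1))` in the smooth part
    have hl (n K l : ℕ) (hn : 1 ≤ n) (hl : 1 ≤ l) (hK : K = n * (l + 1))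
        (hq : ∀ j, ∀ q < n, zcoeff 0 q (jetAtZero (h' j)) = 0) :
        ∑ j, zcoeff 0 n (jetAtZero (h' j)) ^ (l + 1) = 0 := by
      have hlK : l < K := by nlinarith
      have h0 := zcoeff_eq_zero_of_lt_order (p := K - l) (q := n * (l + 1) + K) (key K).1 (by omega)
      have hdvd0 (j : Fin m) (q : ℕ) : zcoeff 0 q (jetAtZero (h j)) = 0 := by
        obtain ⟨A, hA⟩ := hdvd j
        simpa [hA] using zcoeff_X_pow_mul_of_lt (p := 0) (q := q) one_pos A
      have hw (j : Fin m) := zcoeff_logPoly hn hl hlK (hh j).two_le_order fun q _ => hdvd0 j q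
      have hw' (j : Fin m) := zcoeff_logPoly hn hl hlK (hh' j).two_le_order (hq j)
      have hlt : K - l < K := by omega
      simp only [zcoeff_add, zcoeff_sub, zcoeff_sum, mul_pow, mul_assoc,
        zcoeff_X_pow_mul_of_lt hlt, zcoeff_X_one_pow_mul, hw, hw', hdvd0] at h0
      simp only [zero_pow l.succ_ne_zero, mul_zero, sub_zero, Finset.sum_const_zero, add_zero,
        zero_sub, neg_eq_zero, ← Finset.mul_sum] at h0
      have hl0 : (l : ℂ) ≠ 0 := by exact_mod_cast (by omega : l ≠ 0)
      have hl1 : (l : ℂ) + 1 ≠ 0 := by exact_mod_cast l.succ_ne_zero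
      have hne : (1 / (l + 1) - 1 / l : ℂ) ≠ 0 := by
        rw [div_sub_div _ _ hl1 hl0]
        refine div_ne_zero ?_ (mul_ne_zero hl1 hl0)
        ring_nf
        norm_num
      simpa [hne, sub_eq_zero] using h0
    have hzero : ∀ n, ∀ j, zcoeff 0 n (jetAtZero (h' j)) = 0 := by
      intro n
      induction n using Nat.strong_induction_on with
      | _ n ih =>
        rcases Nat.eq_zero_or_pos n with rfl | hn
        · exact fun j => MvPowerSeries.coeff_of_lt_order
            (lt_of_lt_of_le (by simp) (hh' j).two_le_order)
        · exact eq_zero_of_sum_pow_eq_zero _ fun l hl' =>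
            hl n _ l hn hl' rfl fun j q hq => ih q hq j
    intro j
    refine MvPowerSeries.X_dvd_iff.2 fun d hd => ?_
    have hd1 : d = Finsupp.single 0 0 + Finsupp.single 1 (d 1) := by
      ext i; fin_cases i <;> simp [hd]
    rw [hd1]
    exact hzero (d 1) j
  · refine (sub_eq_zero.1 (MvPowerSeries.ext fun d => ?_)).symm
    have h0 := zcoeff_eq_zero_of_lt_order (p := d 0 + (d 0 + d 1)) (q := d 1 + (d 0 + d 1))
      (key (d 0 + d 1)).2 (by omega)
    rw [mul_pow, mul_assoc, mul_left_comm, zcoeff_X_pow_mul, mul_left_comm, zcoeff_X_one_pow_mul,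
      zcoeff, MvPowerSeries.coeff_C_mul] at h0
    have hd : d = Finsupp.single 0 (d 0) + Finsupp.single 1 (d 1) := by
      ext i; fin_cases i <;> simp
    rw [hd, map_zero (MvPowerSeries.coeff (R := ℂ) _)]
    simpa using h0

end LogDifference

/-! ### The linear part and the coordinate `ζ` -/

theorem IsDiffeoGerm.smoothGerm {G : ℂ → ℂ} (hG : IsDiffeoGerm G) : SmoothGerm G := by
  obtain ⟨-, e, h0, he, -, heq⟩ := hG
  filter_upwards [e.open_source.mem_nhds h0] with z hz
  exact ((he.congr heq).contDiffAt (e.open_source.mem_nhds hz))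

theorem zcoeff_one_zero_jetAtZero (G : ℂ → ℂ) : zcoeff 1 0 (jetAtZero G) = wirtingerD G 0 := by
  simp [zcoeff, coeff_jetAtZero]

theorem zcoeff_zero_one_jetAtZero (G : ℂ → ℂ) : zcoeff 0 1 (jetAtZero G) = wirtingerDbar G 0 := by
  simp [zcoeff, coeff_jetAtZero]

/-- The linear part of an element of `𝔙₊` is determined by its first-order invariant, which has
modulus less than one. -/
theorem linearPart_of_mem_diffeoVPlus {G : ℂ → ℂ} {μ : ℂ} (hG : G ∈ diffeoVPlus)
    (hμ : firstOrderInvariant (jetAtZero G) = μ) :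
    ‖μ‖ < 1 ∧ wirtingerD G 0 = 1 / (1 + conj μ) ∧ wirtingerDbar G 0 = μ / (1 + μ) := by
  obtain ⟨hdiff, hre, hpos⟩ := hG
  rw [firstOrderInvariant, zcoeff_one_zero_jetAtZero, zcoeff_zero_one_jetAtZero] at hμ
  have hd : HasFDerivAt G _ 0 := hdiff.smoothGerm.hasFDerivAt.self_of_nhds
  set a := wirtingerD G 0
  set b := wirtingerDbar G 0
  have hre' : HasFDerivAt (fun z => (G z).re) (Complex.reCLM ∘SL wirtingerCLM a b) 0 :=
    Complex.reCLM.hasFDerivAt.comp 0 hd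
  have him' : HasFDerivAt (fun z => (G z).im) (Complex.imCLM ∘SL wirtingerCLM a b) 0 :=
    Complex.imCLM.hasFDerivAt.comp 0 hd
  have hrew : Complex.reCLM ∘SL wirtingerCLM a b = Complex.reCLM :=
    hre'.unique (Complex.reCLM.hasFDerivAt.congr_of_eventuallyEq hre)
  have h1 := DFunLike.congr_fun hrew 1
  have h2 := DFunLike.congr_fun hrew Complex.I
  have h3 := hpos.self_of_nhds
  rw [him'.fderiv] at h3
  simp at h1 h2 h3
  have ha : conj a = 1 - b := by
    apply Complex.ext <;> simp <;> linarith
  have hb : 1 - b ≠ 0 := by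
    intro h
    have := congrArg Complex.re h
    simp at this
    linarith
  rw [ha] at hμ
  have hμ1 : 1 + μ = 1 / (1 - b) := by rw [← hμ]; field_simp; ring
  have hb' : μ / (1 + μ) = b := by rw [hμ1, ← hμ]; field_simp
  refine ⟨?_, ?_, hb'.symm⟩
  · rw [← hμ, norm_div, div_lt_one (by simpa using hb), ← sq_lt_sq₀ (norm_nonneg _) (norm_nonneg _),
      ← Complex.normSq_eq_norm_sq, ← Complex.normSq_eq_norm_sq, Complex.normSq_apply,
      Complex.normSq_apply]
    simp
    nlinarith
  · have : 1 + conj μ = conj (1 + μ) := by simp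
    rw [this, hμ1, ← Complex.conj_conj a, ha]
    simp

theorem one_add_ne_zero_of_norm_lt_one {μ : ℂ} (hμ : ‖μ‖ < 1) : 1 + μ ≠ 0 := by
  intro h
  have : μ = -1 := by linear_combination h
  simp [this] at hμ

/-- The linear form `Z_μ`, evaluated at `z, z̄`, is a real-linear isomorphism. -/
theorem exists_muCoordinate {μ : ℂ} (hμ : ‖μ‖ < 1) :
    ∃ e : ℂ ≃L[ℝ] ℂ, ∀ z, e z = 1 / (1 + conj μ) * z + μ / (1 + μ) * conj z := by
  have h1 := one_add_ne_zero_of_norm_lt_one hμ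
  have hn : ‖1 + conj μ‖ = ‖1 + μ‖ := by
    rw [← RCLike.norm_conj (1 + μ)]; simp
  have hinj : Function.Injective
      (wirtingerCLM (1 / (1 + conj μ)) (μ / (1 + μ)) : ℂ →ₗ[ℝ] ℂ) := by
    refine (injective_iff_map_eq_zero _).2 fun z hz => ?_
    have hz : 1 / (1 + conj μ) * z + μ / (1 + μ) * conj z = 0 := by simpa using hz
    have h2 : ‖1 / (1 + conj μ) * z‖ = ‖μ / (1 + μ) * conj z‖ := by
      rw [eq_neg_of_add_eq_zero_left hz, norm_neg]
    rw [norm_mul, norm_mul, norm_div, norm_div, RCLike.norm_conj, hn, norm_one] at h2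
    have h3 : 0 < ‖1 + μ‖ := norm_pos_iff.2 h1
    field_simp at h2
    by_contra hz0
    have : 0 < ‖z‖ := norm_pos_iff.2 hz0
    nlinarith
  exact ⟨(LinearEquiv.ofInjectiveEndo _ hinj).toContinuousLinearEquiv, fun z => by simp⟩

theorem re_muCoordinate {μ : ℂ} (hμ : ‖μ‖ < 1) (z : ℂ) :
    (1 / (1 + conj μ) * z + μ / (1 + μ) * conj z).re = z.re := by
  have h1 := one_add_ne_zero_of_norm_lt_one hμ
  have h2 : 1 + conj μ ≠ 0 := one_add_ne_zero_of_norm_lt_one (by rwa [RCLike.norm_conj])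
  have h3 : (μ / (1 + μ) * conj z).re = (conj μ / (1 + conj μ) * z).re := by
    rw [← Complex.conj_re]; simp
  rw [Complex.add_re, h3, ← Complex.add_re]
  congr 1
  field_simp

/-- In the coordinate `ζ = e z` given by the common linear part, an element of `𝔙₊` is a vertical
displacement. -/
theorem isVerticalDisplacement_of_mem_diffeoVPlus {G : ℂ → ℂ} {μ : ℂ} (hG : G ∈ diffeoVPlus)
    (hμ : firstOrderInvariant (jetAtZero G) = μ) {e : ℂ ≃L[ℝ] ℂ}
    (he : ∀ z, e z = 1 / (1 + conj μ) * z + μ / (1 + μ) * conj z) :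
    IsVerticalDisplacement fun ζ => G (e.symm ζ) - ζ := by
  obtain ⟨hμ1, ha, hb⟩ := linearPart_of_mem_diffeoVPlus hG hμ
  obtain ⟨hdiff, hre, -⟩ := hG
  have hG := hdiff.smoothGerm
  have htend : Tendsto e.symm (𝓝 0) (𝓝 0) := by simpa using e.symm.continuous.tendsto 0
  have hsm : SmoothGerm fun ζ => G (e.symm ζ) - ζ :=
    (hG.comp_continuousLinearEquiv e.symm).sub SmoothGerm.id
  refine ⟨hsm, ?_, ?_⟩
  · have hr : SmoothGerm fun z => G z - e z := hG.sub (SmoothGerm.of_contDiff e.contDiff)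
    have hrd : HasFDerivAt (fun z => G z - e z) (wirtingerCLM 0 0) 0 := by
      refine (hG.hasFDerivAt.self_of_nhds.sub e.hasFDerivAt).congr_fderiv
        (ContinuousLinearMap.ext fun v => ?_)
      simp [ha, hb, he]
    have hord : ((2 : ℕ) : ℕ∞) ≤ (jetAtZero fun z => G z - e z).order := by
      rw [nat_le_order_jetAtZero_iff]
      intro p q hpq
      have : (p = 0 ∧ q = 0) ∨ (p = 1 ∧ q = 0) ∨ (p = 0 ∧ q = 1) := by omega
      rcases this with ⟨rfl, rfl⟩ | ⟨rfl, rfl⟩ | ⟨rfl, rfl⟩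
      · simp [hdiff.1]
      · simpa using (wirtinger_of_hasFDerivAt hrd).1
      · simpa using (wirtinger_of_hasFDerivAt hrd).2
    have hO := ((hr.isBigO_of_order_jetAtZero hord).comp_tendsto htend).trans
      (((e.symm : ℂ →L[ℝ] ℂ).isBigO_id (𝓝 0)).norm_norm.pow 2)
    have := hsm.hasExpansion.le_order (N := 2) (by simpa [Function.comp_def] using hO)
    exact_mod_cast this
  · filter_upwards [htend.eventually hre] with ζ hζ
    have h1 := re_muCoordinate hμ1 (e.symm ζ)
    rw [← he, e.apply_symm_apply] at h1
    simp [hζ, h1]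

/-- Liftability means that the displacement in the coordinate `ζ` has a jet divisible by the
coordinate. -/
theorem isMuLiftable_iff {G : ℂ → ℂ} {μ : ℂ} {e : ℂ ≃L[ℝ] ℂ}
    (he : ∀ z, e z = 1 / (1 + conj μ) * z + μ / (1 + μ) * conj z) (hG : SmoothGerm G) :
    IsMuLiftable μ (jetAtZero G) ↔
      (MvPowerSeries.X 0 : CSeries) ∣ jetAtZero fun ζ => G (e.symm ζ) - ζ := by
  have hG' : SmoothGerm fun ζ => G (e.symm ζ) := hG.comp_continuousLinearEquiv e.symm
  have hB (B : CSeries) : IsMuExpansion μ (jetAtZero G) B ↔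
      B = jetAtZero fun ζ => G (e.symm ζ) := by
    have h1 := hasExpansion_comp_linear_iff (f := fun ζ => G (e.symm ζ)) (B := B) e he
    have h2 : (![MvPowerSeries.C (1 / (1 + conj μ)) * MvPowerSeries.X 0 +
        MvPowerSeries.C (μ / (1 + μ)) * MvPowerSeries.X 1,
        MvPowerSeries.C (conj (μ / (1 + μ))) * MvPowerSeries.X 0 +
          MvPowerSeries.C (conj (1 / (1 + conj μ))) * MvPowerSeries.X 1] : Fin 2 → CSeries) =
        ![zMu μ, zBarMu μ] := by simp [zMu, zBarMu]
    simp only [e.symm_apply_apply, h2] at h1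
    rw [IsMuExpansion]
    constructor
    · intro h
      rw [h] at h1
      exact (h1.1 hG.hasExpansion).unique hG'.hasExpansion
    · rintro rfl
      exact (h1.2 hG'.hasExpansion).unique hG.hasExpansion
  have hX : jetAtZero (fun ζ => G (e.symm ζ) - ζ) =
      jetAtZero (fun ζ => G (e.symm ζ)) - MvPowerSeries.X 0 := by
    rw [hG'.jetAtZero_sub SmoothGerm.id, SmoothGerm.id.hasExpansion.unique HasExpansion.id]
  rw [hX, dvd_sub_self_right, MvPowerSeries.X_dvd_iff]
  simp only [IsMuLiftable, hB, exists_eq_left]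
  constructor
  · intro h d hd
    have : d = Finsupp.single 0 0 + Finsupp.single 1 (d 1) := by
      ext i; fin_cases i <;> simp [hd]
    rw [this]
    exact h (d 1)
  · exact fun h q => h _ (by simp)

/-! ### Logarithms on the universal cover -/

section Logarithm

variable {e : ℂ ≃L[ℝ] ℂ} {a b : ℂ}

/-- A logarithm of the linear form `a z + b z̄`, `|b| < |a|`, on the universal cover. -/
theorem exists_log_linear (he : ∀ z, e z = a * z + b * conj z) (hab : ‖b‖ < ‖a‖) :
    ∃ ℓ : ℂ → ℂ, Continuous ℓ ∧ ∀ w, Complex.exp (ℓ w) = e (Complex.exp w) := by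
  have ha : a ≠ 0 := norm_pos_iff.1 ((norm_nonneg b).trans_lt hab)
  have hmem (w : ℂ) : 1 + b / a * Complex.exp (conj w - w) ∈ Complex.slitPlane := by
    refine Complex.mem_slitPlane_of_norm_lt_one ?_
    rw [norm_mul, Complex.norm_exp, norm_div]
    simpa [div_lt_one (norm_pos_iff.2 ha)] using hab
  refine ⟨fun w => w + Complex.log a + Complex.log (1 + b / a * Complex.exp (conj w - w)), ?_,
    fun w => ?_⟩
  · refine (by fun_prop : Continuous fun w : ℂ => w + Complex.log a).add ?_
    refine Continuous.clog ?_ hmem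
    exact continuous_const.add (continuous_const.mul
      (Complex.continuous_exp.comp (Complex.continuous_conj.sub continuous_id)))
  · rw [Complex.exp_add, Complex.exp_add, Complex.exp_log ha,
      Complex.exp_log (Complex.slitPlane_ne_zero (hmem w)), he, ← Complex.exp_conj, Complex.exp_sub]
    field_simp

/-- A property that holds near the origin in the coordinate `ζ = e z` holds on a half plane of the
universal cover `w ↦ exp w`; `eventually_of_halfPlane` is the converse. -/
theorem exists_halfPlane {p : ℂ → Prop} (e : ℂ ≃L[ℝ] ℂ) (hp : ∀ᶠ ζ in 𝓝[≠] 0, p ζ) :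
    ∃ R : ℝ, ∀ w : ℂ, w.re < R → p (e (Complex.exp w)) := by
  have h1 : Tendsto (fun z => e z) (𝓝[≠] 0) (𝓝[≠] 0) := by
    refine tendsto_nhdsWithin_iff.2 ⟨?_, ?_⟩
    · simpa using (e.continuous.tendsto 0).mono_left nhdsWithin_le_nhds
    · filter_upwards [self_mem_nhdsWithin] with z hz
      simpa using hz
  obtain ⟨r, hr, hball⟩ := Metric.mem_nhdsWithin_iff.1 (h1.eventually hp)
  refine ⟨Real.log r, fun w hw => hball ⟨?_, Complex.exp_ne_zero w⟩⟩
  rw [mem_ball_zero_iff, Complex.norm_exp]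
  exact (Real.lt_log_iff_exp_lt hr).1 hw

theorem eventually_of_halfPlane {p : ℂ → Prop} (e : ℂ ≃L[ℝ] ℂ) {R : ℝ}
    (hp : ∀ w : ℂ, w.re < R → p (e (Complex.exp w))) : ∀ᶠ ζ in 𝓝[≠] 0, p ζ := by
  have h1 : Tendsto e.symm (𝓝[≠] 0) (𝓝 0) := by
    simpa using (e.symm.continuous.tendsto 0).mono_left nhdsWithin_le_nhds
  filter_upwards [h1.eventually (Metric.ball_mem_nhds 0 (Real.exp_pos R)), self_mem_nhdsWithin]
    with ζ hζ hζ0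
  have hne : e.symm ζ ≠ 0 := by simpa using hζ0
  have := hp (Complex.log (e.symm ζ)) (by
    rw [Complex.log_re]
    exact (Real.log_lt_iff_lt_exp (norm_pos_iff.2 hne)).2 (by simpa using hζ))
  rwa [Complex.exp_log hne, e.apply_symm_apply] at this

/-- Two determinations of a logarithm on a half plane differ by a constant multiple of `2πi`. -/
theorem exists_int_of_exp_eq {L L' : ℂ → ℂ} {R : ℝ} (hL : ContinuousOn L {w : ℂ | w.re < R})
    (hL' : ContinuousOn L' {w : ℂ | w.re < R})
    (h : ∀ w : ℂ, w.re < R → Complex.exp (L w) = Complex.exp (L' w)) :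
    ∃ n : ℤ, ∀ w : ℂ, w.re < R → L w = L' w + n * (2 * Real.pi * Complex.I) := by
  have hconn : IsPreconnected {w : ℂ | w.re < R} := (convex_halfSpace_re_lt R).isPreconnected
  have hdisc : DiscreteTopology (Set.range ((↑) : ℤ → ℝ)) :=
    Int.isClosedEmbedding_coe_real.isEmbedding.toHomeomorph.discreteTopology
  have hcont : ContinuousOn (fun w => ((L w - L' w) / (2 * Real.pi * Complex.I)).re)
      {w : ℂ | w.re < R} :=
    Complex.continuous_re.comp_continuousOn ((hL.sub hL').div_const _)
  have hint (w : ℂ) (hw : w.re < R) : ∃ n : ℤ, L w = L' w + n * (2 * Real.pi * Complex.I) :=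
    Complex.exp_eq_exp_iff_exists_int.1 (h w hw)
  have hval (w : ℂ) (n : ℤ) (hn : L w = L' w + n * (2 * Real.pi * Complex.I)) :
      ((L w - L' w) / (2 * Real.pi * Complex.I)).re = n := by
    rw [hn, add_sub_cancel_left, mul_div_assoc, div_self Complex.two_pi_I_ne_zero, mul_one]
    simp
  obtain ⟨y, ⟨n, rfl⟩, hy⟩ := hconn.eqOn_const_of_mapsTo ⟨hdisc⟩ hcont
    (fun w hw => by
      obtain ⟨n, hn⟩ := hint w hw
      exact ⟨n, (hval w n hn).symm⟩) ⟨_, 0, rfl⟩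
  refine ⟨n, fun w hw => ?_⟩
  obtain ⟨k, hk⟩ := hint w hw
  have h1 : ((L w - L' w) / (2 * Real.pi * Complex.I)).re = n := hy hw
  rw [hval w k hk] at h1
  rw [hk, Int.cast_injective h1]

end Logarithm

/-! ### Admissibility in the coordinate `ζ` -/

section Admissible

variable {e : ℂ ≃L[ℝ] ℂ} {ℓ : ℂ → ℂ}

/-- The determination `ln ζ + ln (1 + h / ζ)` of `ln G`, where `G = ζ + h`. -/
theorem isLogOf_add_log {G : ℂ → ℂ} (hℓ : Continuous ℓ)
    (hexp : ∀ w, Complex.exp (ℓ w) = e (Complex.exp w))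
    (hh : IsVerticalDisplacement fun ζ => G (e.symm ζ) - ζ) :
    IsLogOf G fun w => ℓ w + Complex.log
      (1 + (G (Complex.exp w) - e (Complex.exp w)) / e (Complex.exp w)) := by
  have h1 : ∀ᶠ ζ in 𝓝[≠] (0 : ℂ), ContDiffAt ℝ ∞ (fun ζ => G (e.symm ζ) - ζ) ζ ∧
      (G (e.symm ζ) - ζ) / ζ ∈ Metric.ball (0 : ℂ) 1 :=
    nhdsWithin_le_nhds (hh.smooth.and (hh.tendsto_div.eventually (Metric.ball_mem_nhds 0 one_pos)))
  obtain ⟨R, hR⟩ := exists_halfPlane e h1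
  have hmem (w : ℂ) (hw : w.re < R) :
      1 + (G (Complex.exp w) - e (Complex.exp w)) / e (Complex.exp w) ∈ Complex.slitPlane := by
    have := (hR w hw).2
    rw [e.symm_apply_apply, mem_ball_zero_iff] at this
    exact Complex.mem_slitPlane_of_norm_lt_one this
  have hne (w : ℂ) : e (Complex.exp w) ≠ 0 := by simp
  refine ⟨R, fun w hw => ContinuousAt.continuousWithinAt ?_, fun w hw => ?_⟩
  · have hc : ContinuousAt (fun w => e (Complex.exp w)) w := by fun_prop
    have hd : ContinuousAt (fun w => G (Complex.exp w) - e (Complex.exp w)) w := by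
      have := ContinuousAt.comp (f := fun w => e (Complex.exp w))
        (hR w hw).1.continuousAt hc
      simpa [Function.comp_def] using this
    exact hℓ.continuousAt.add ((continuousAt_const.add (hd.div hc (hne w))).clog (hmem w hw))
  · rw [Complex.exp_add, Complex.exp_log (Complex.slitPlane_ne_zero (hmem w hw)), hexp]
    field_simp [hne w]
    ring

/-- The change of the determination of `ln G` adds `2πn Re G = 2πn Re ζ`. -/
theorem im_mul_log_sub {G L : ℂ → ℂ} (hℓ : Continuous ℓ)
    (hexp : ∀ w, Complex.exp (ℓ w) = e (Complex.exp w))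
    (hh : IsVerticalDisplacement fun ζ => G (e.symm ζ) - ζ) (hL : IsLogOf G L) :
    ∃ n : ℤ, ∃ R : ℝ, ∀ w : ℂ, w.re < R →
      (G (Complex.exp w) * L w - G (Complex.exp w)).im =
        (G (Complex.exp w) * ℓ w).im +
          (logRemainder (fun ζ => G (e.symm ζ) - ζ) (e (Complex.exp w))).im +
          2 * Real.pi * n * (e (Complex.exp w)).re := by
  obtain ⟨R₁, hc₁, h₁⟩ := hL
  obtain ⟨R₂, hc₂, h₂⟩ := isLogOf_add_log hℓ hexp hh
  obtain ⟨R₃, h₃⟩ := exists_halfPlane e (nhdsWithin_le_nhds hh.re_eq_zero)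
  have hR {w : ℂ} (hw : w.re < min (min R₁ R₂) R₃) : w.re < R₁ ∧ w.re < R₂ ∧ w.re < R₃ :=
    ⟨hw.trans_le ((min_le_left _ _).trans (min_le_left _ _)),
      hw.trans_le ((min_le_left _ _).trans (min_le_right _ _)), hw.trans_le (min_le_right _ _)⟩
  obtain ⟨n, hn⟩ := exists_int_of_exp_eq (R := min (min R₁ R₂) R₃)
    (hc₁.mono fun w hw => (hR hw).1) (hc₂.mono fun w hw => (hR hw).2.1)
    fun w hw => by rw [h₁ w (hR hw).1, h₂ w (hR hw).2.1]
  refine ⟨n, min (min R₁ R₂) R₃, fun w hw => ?_⟩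
  have hre := h₃ w (hR hw).2.2
  rw [e.symm_apply_apply, Complex.sub_re, sub_eq_zero] at hre
  rw [hn w hw, logRemainder, e.symm_apply_apply, add_sub_cancel, ← hre]
  set g := G (Complex.exp w)
  have e1 : g * (ℓ w + Complex.log (1 + (g - e (Complex.exp w)) / e (Complex.exp w)) +
      n * (2 * Real.pi * Complex.I)) - g = g * ℓ w +
      (g * Complex.log (1 + (g - e (Complex.exp w)) / e (Complex.exp w)) - g) +
      ((2 * Real.pi * n : ℝ) : ℂ) * (g * Complex.I) := by push_cast; ring
  rw [e1, Complex.add_im, Complex.add_im, Complex.im_ofReal_mul]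
  simp

theorem sumImGLogG_eq {m : ℕ} {G L : Fin m → ℂ → ℂ} (hℓ : Continuous ℓ)
    (hexp : ∀ w, Complex.exp (ℓ w) = e (Complex.exp w))
    (hh : ∀ j, IsVerticalDisplacement fun ζ => G j (e.symm ζ) - ζ) (hL : ∀ j, IsLogOf (G j) (L j)) :
    ∃ n : ℤ, ∃ R : ℝ, ∀ w : ℂ, w.re < R →
      sumImGLogG G L w = ((∑ j, G j (Complex.exp w)) * ℓ w).im +
          ∑ j, (logRemainder (fun ζ => G j (e.symm ζ) - ζ) (e (Complex.exp w))).im +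
          2 * Real.pi * n * (e (Complex.exp w)).re := by
  choose n R hR using fun j => im_mul_log_sub hℓ hexp (hh j) (hL j)
  obtain ⟨R₀, hR₀⟩ := (Set.finite_range R).bddBelow
  refine ⟨∑ j, n j, R₀, fun w hw => ?_⟩
  rw [sumImGLogG, Finset.sum_congr rfl fun j _ => hR j w (hw.trans_le (hR₀ ⟨j, rfl⟩)),
    Finset.sum_add_distrib, Finset.sum_add_distrib, Finset.sum_mul, Complex.im_sum]
  push_cast
  rw [Finset.mul_sum, Finset.sum_mul]

theorem sumImGLogG_sub {m : ℕ} {G G' L L' : Fin m → ℂ → ℂ} (hℓ : Continuous ℓ)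
    (hexp : ∀ w, Complex.exp (ℓ w) = e (Complex.exp w))
    (hh : ∀ j, IsVerticalDisplacement fun ζ => G j (e.symm ζ) - ζ)
    (hh' : ∀ j, IsVerticalDisplacement fun ζ => G' j (e.symm ζ) - ζ)
    (hL : ∀ j, IsLogOf (G j) (L j)) (hL' : ∀ j, IsLogOf (G' j) (L' j)) :
    ∃ n : ℤ, ∃ R : ℝ, ∀ w : ℂ, w.re < R →
      sumImGLogG G' L' w - sumImGLogG G L w =
        logDifference (fun j ζ => G j (e.symm ζ) - ζ) (fun j ζ => G' j (e.symm ζ) - ζ)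
          (e (Complex.exp w)) + 2 * Real.pi * n * (e (Complex.exp w)).re := by
  obtain ⟨n, R, hR⟩ := sumImGLogG_eq hℓ hexp hh hL
  obtain ⟨n', R', hR'⟩ := sumImGLogG_eq hℓ hexp hh' hL'
  obtain ⟨R₃, h₃⟩ := exists_halfPlane e (nhdsWithin_le_nhds
    ((eventually_all.2 fun j => (hh j).re_eq_zero).and
      (eventually_all.2 fun j => (hh' j).re_eq_zero)))
  refine ⟨n' - n, min (min R R') R₃, fun w hw => ?_⟩
  obtain ⟨hre, hre'⟩ := h₃ w (hw.trans_le (min_le_right _ _))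
  rw [hR w (hw.trans_le ((min_le_left _ _).trans (min_le_left _ _))),
    hR' w (hw.trans_le ((min_le_left _ _).trans (min_le_right _ _))), logDifference]
  simp only [e.symm_apply_apply] at hre hre' ⊢
  have hsub : ∑ j, (G' j (Complex.exp w) - e (Complex.exp w)) -
      ∑ j, (G j (Complex.exp w) - e (Complex.exp w)) =
      ∑ j, G' j (Complex.exp w) - ∑ j, G j (Complex.exp w) := by
    rw [Finset.sum_sub_distrib, Finset.sum_sub_distrib]; ring
  -- the sum of the displacements is imaginary, so only the real part of `ℓ` contributes
  have hreal : (∑ j, G' j (Complex.exp w) - ∑ j, G j (Complex.exp w)).re = 0 := by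
    rw [← hsub, Complex.sub_re, Complex.re_sum, Complex.re_sum]
    simp only [hre, hre', Finset.sum_const_zero, sub_self]
  have hℓre : (ℓ w).re = Real.log ‖e (Complex.exp w)‖ := by
    rw [← hexp, Complex.norm_exp, Real.log_exp]
  have him : ((∑ j, G' j (Complex.exp w)) * ℓ w).im - ((∑ j, G j (Complex.exp w)) * ℓ w).im =
      (∑ j, G' j (Complex.exp w) - ∑ j, G j (Complex.exp w)).im *
        Real.log ‖e (Complex.exp w)‖ := by
    rw [← Complex.sub_im, ← sub_mul, Complex.mul_im, hreal, hℓre]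
    ring
  rw [hsub, ← him]
  push_cast
  ring

/-- Every smooth germ is the germ of a globally smooth function. -/
theorem SmoothGerm.exists_contDiff {f : ℂ → ℂ} (hf : SmoothGerm f) :
    ∃ S : ℂ → ℂ, ContDiff ℝ ∞ S ∧ S =ᶠ[𝓝 0] f := by
  obtain ⟨r, hr, hball⟩ := Metric.eventually_nhds_iff_ball.1 hf
  let χ : ContDiffBump (0 : ℂ) := ⟨r / 3, r / 2, by positivity, by linarith⟩
  refine ⟨fun z => χ z • f z, contDiff_iff_contDiffAt.2 fun z => ?_, ?_⟩
  · by_cases hz : z ∈ Metric.ball (0 : ℂ) r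
    · exact χ.contDiff.contDiffAt.smul (hball z hz)
    · have hz : z ∈ (Metric.closedBall (0 : ℂ) (r / 2))ᶜ := by
        simp only [mem_ball_zero_iff, not_lt, Set.mem_compl_iff, mem_closedBall_zero_iff,
          not_le] at hz ⊢
        linarith
      refine contDiffAt_const (c := (0 : ℂ)) |>.congr_of_eventuallyEq ?_
      filter_upwards [Metric.isClosed_closedBall.isOpen_compl.mem_nhds hz] with w hw
      have : χ w = 0 := χ.zero_of_le_dist (by
        simp only [Set.mem_compl_iff, Metric.mem_closedBall, not_le] at hw
        exact hw.le)
      rw [this, zero_smul]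
  · filter_upwards [χ.eventuallyEq_one] with z hz
    rw [hz]; simp

/-- Admissibility says that the difference of the logarithmic terms in the coordinate `ζ` is smooth
at the origin. -/
theorem affineAdmissible_iff {m : ℕ} {G G' : Fin m → ℂ → ℂ} (hℓ : Continuous ℓ)
    (hexp : ∀ w, Complex.exp (ℓ w) = e (Complex.exp w))
    (hh : ∀ j, IsVerticalDisplacement fun ζ => G j (e.symm ζ) - ζ)
    (hh' : ∀ j, IsVerticalDisplacement fun ζ => G' j (e.symm ζ) - ζ) :
    AffineAdmissible G G' ↔ ∃ S : ℂ → ℂ, SmoothGerm S ∧ ∀ᶠ ζ in 𝓝[≠] (0 : ℂ), S ζ =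
      logDifference (fun j ζ => G j (e.symm ζ) - ζ) (fun j ζ => G' j (e.symm ζ) - ζ) ζ := by
  have hre (n : ℤ) : SmoothGerm fun ζ : ℂ => ((2 * Real.pi * n * ζ.re : ℝ) : ℂ) :=
    SmoothGerm.of_contDiff
      (Complex.ofRealCLM.contDiff.comp (contDiff_const.mul Complex.reCLM.contDiff))
  constructor
  · rintro ⟨L, L', hL, hL', S, hS, R, hR⟩
    obtain ⟨n, R', hR'⟩ := sumImGLogG_sub hℓ hexp hh hh' hL hL'
    refine ⟨fun ζ => S (e.symm ζ) - ((2 * Real.pi * n * ζ.re : ℝ) : ℂ),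
      ((SmoothGerm.of_contDiff hS).comp_continuousLinearEquiv e.symm).sub (hre n),
      eventually_of_halfPlane (R := min R R') e fun w hw => ?_⟩
    have h1 := hR w (hw.trans_le (min_le_left _ _))
    beta_reduce at h1 ⊢
    rw [e.symm_apply_apply, ← h1,
      hR' w (hw.trans_le (min_le_right _ _))]
    push_cast
    ring
  · rintro ⟨S, hS, heq⟩
    have hL := fun j => isLogOf_add_log hℓ hexp (hh j)
    have hL' := fun j => isLogOf_add_log hℓ hexp (hh' j)
    obtain ⟨n, R', hR'⟩ := sumImGLogG_sub hℓ hexp hh hh' hL hL'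
    obtain ⟨T, hT, hTS⟩ := (hS.add (hre n)).exists_contDiff
    obtain ⟨R, hR⟩ := exists_halfPlane e (heq.and (nhdsWithin_le_nhds hTS))
    refine ⟨_, _, hL, hL', fun z => T (e z), hT.comp e.contDiff, min R R', fun w hw => ?_⟩
    obtain ⟨h1, h2⟩ := hR w (hw.trans_le (min_le_left _ _))
    beta_reduce at h2 ⊢
    rw [hR' w (hw.trans_le (min_le_right _ _)), h2, h1]
    push_cast
    ring

end Admissible

/-- The characterization of admissibility for given representatives. -/
theorem affineAdmissible_iff_of_represents {m : ℕ} {μ : ℂ} {A A' : Fin m → CSeries}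
    (hμ : ∀ j, firstOrderInvariant (A j) = μ) (hμ' : ∀ j, firstOrderInvariant (A' j) = μ)
    (hlift : ∀ j, IsMuLiftable μ (A j)) {G G' : Fin m → ℂ → ℂ} (hG : Represents G A)
    (hG' : Represents G' A') :
    AffineAdmissible G G' ↔ (∀ j, IsMuLiftable μ (A' j)) ∧ ∑ j, A j = ∑ j, A' j := by
  -- for `m = 0` both sides hold trivially, and there is no germ that would give `‖μ‖ < 1`
  rcases isEmpty_or_nonempty (Fin m) with hm | ⟨⟨j₀⟩⟩
  · refine ⟨fun _ => ⟨fun j => hm.elim j, by simp⟩, fun _ => ⟨fun _ _ => 0, fun _ _ => 0,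
      fun j => hm.elim j, fun j => hm.elim j, fun _ => 0, contDiff_const, 0, fun w _ => ?_⟩⟩
    simp [sumImGLogG]
  obtain rfl : A = fun j => jetAtZero (G j) := funext fun j => (hG j).2.symm
  obtain rfl : A' = fun j => jetAtZero (G' j) := funext fun j => (hG' j).2.symm
  have hμ1 : ‖μ‖ < 1 := (linearPart_of_mem_diffeoVPlus (hG j₀).1 (hμ j₀)).1
  obtain ⟨e, he⟩ := exists_muCoordinate hμ1
  obtain ⟨ℓ, hℓ, hexp⟩ := exists_log_linear he (by
    have h1 : ‖1 + conj μ‖ = ‖1 + μ‖ := by rw [← RCLike.norm_conj (1 + μ)]; simp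
    have h2 : 0 < ‖1 + μ‖ := norm_pos_iff.2 (one_add_ne_zero_of_norm_lt_one hμ1)
    rw [norm_div, norm_div, h1, norm_one]
    exact div_lt_div_of_pos_right hμ1 h2)
  have hsm (j) : SmoothGerm (G j) := (hG j).1.1.smoothGerm
  have hsm' (j) : SmoothGerm (G' j) := (hG' j).1.1.smoothGerm
  have hh (j) := isVerticalDisplacement_of_mem_diffeoVPlus (hG j).1 (hμ j) he
  have hh' (j) := isVerticalDisplacement_of_mem_diffeoVPlus (hG' j).1 (hμ' j) he
  have hsum : ∑ j, jetAtZero (G j) = ∑ j, jetAtZero (G' j) ↔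
      ∑ j, jetAtZero (fun ζ => G j (e.symm ζ) - ζ) =
        ∑ j, jetAtZero (fun ζ => G' j (e.symm ζ) - ζ) := by
    have h1 := (HasExpansion.sum (s := Finset.univ) fun j _ => (hsm j).hasExpansion).sub
      (HasExpansion.sum (s := Finset.univ) fun j _ => (hsm' j).hasExpansion)
    have h2 := (HasExpansion.sum (s := Finset.univ) fun j _ => (hh j).smooth.hasExpansion).sub
      (HasExpansion.sum (s := Finset.univ) fun j _ => (hh' j).smooth.hasExpansion)
    have h3 := hasExpansion_comp_linear_iff (B := 0) (f := fun ζ =>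
      ∑ j, (G j (e.symm ζ) - ζ) - ∑ j, (G' j (e.symm ζ) - ζ)) e he
    have h0 (u : Fin 2 → CSeries) (hu : MvPowerSeries.HasSubst u) :
        MvPowerSeries.subst u (0 : CSeries) = 0 := by
      rw [← MvPowerSeries.coe_substAlgHom hu, map_zero]
    rw [h0 _ (MvPowerSeries.hasSubst_of_constantCoeff_zero fun i => by fin_cases i <;> simp)] at h3
    simp only [e.symm_apply_apply, Finset.sum_sub_distrib, sub_sub_sub_cancel_right] at h2 h3
    rw [← sub_eq_zero, ← sub_eq_zero (b := ∑ j, jetAtZero fun ζ => G' j (e.symm ζ) - ζ)]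
    exact ⟨fun h => h2.unique (h3.1 (h ▸ h1)), fun h => h1.unique (h3.2 (h ▸ h2))⟩
  rw [affineAdmissible_iff hℓ hexp hh hh', hsum]
  simp only [isMuLiftable_iff he (hsm _)] at hlift
  simp only [isMuLiftable_iff he (hsm' _)]
  constructor
  · rintro ⟨S, hS, heq⟩
    exact jets_of_smooth_logDifference hh hh' hlift hS heq
  · rintro ⟨hlift', hs⟩
    exact ⟨_, smoothGerm_logDifference hh hh' hlift hlift' hs, Eventually.of_forall fun _ => rfl⟩

theorem mainTheorem4 (m : ℕ) (μ : ℂ) (A A' : Fin m → CSeries)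
    (hA : ∀ j, A j ∈ jetVPlus) (hA' : ∀ j, A' j ∈ jetVPlus)
    (hμ : ∀ j, firstOrderInvariant (A j) = μ) (hμ' : ∀ j, firstOrderInvariant (A' j) = μ)
    (hlift : ∀ j, IsMuLiftable μ (A j)) :
    (JetAffineAdmissible A A' ↔ (∀ j, IsMuLiftable μ (A' j)) ∧ ∑ j, A j = ∑ j, A' j) ∧
      ∀ G G' : Fin m → ℂ → ℂ, Represents G A → Represents G' A' →
        (AffineAdmissible G G' ↔ JetAffineAdmissible A A') := by
  have hjet : JetAffineAdmissible A A' ↔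
      (∀ j, IsMuLiftable μ (A' j)) ∧ ∑ j, A j = ∑ j, A' j := by
    constructor
    · rintro ⟨G, G', hG, hG', h⟩
      exact (affineAdmissible_iff_of_represents hμ hμ' hlift hG hG').1 h
    · intro h
      choose G hG using hA
      choose G' hG' using hA'
      exact ⟨G, G', hG, hG', (affineAdmissible_iff_of_represents hμ hμ' hlift hG hG').2 h⟩
  exact ⟨hjet, fun G G' hG hG' =>
    (affineAdmissible_iff_of_represents hμ hμ' hlift hG hG').trans hjet.symm⟩
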